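/- Let $1\le m\le n-2$ and $r=n-m-1$. Let $C^n$ be the $n$-dimensional conformal space, identified with the unit sphere $S^n\subset\mathbb R^{n+1}$. Equip $\mathbb R^{n+2}=\mathbb R^{n+1}\times\mathbb R$ with the form $((a,b),(a',b'))=\langle a,a'\rangle-bb'$. The Darboux mapping sends $s\in C^n$ to the point $[s:1]$ of the Darboux hyperquadric $Q^n=\{(X,X)=0\}\subset P^{n+1}$, and the hypersphere $\{s:\langle a,s\rangle=b\}$, where $|a|^2>b^2$, to the point $[a:b]$ outside $Q^n$. Let $V^{n-1}$ be a (smooth, immersed) $m$-canal hypersurface in $C^n$. That is, $V^{n-1}$ is the envelope of a smooth $r$-parameter family of hyperspheres, whose images under the Darboux mapping are the points $z(w)$, $w\in W$, $\dim W=r$, and form an immersed $r$-dimensional submanifold $U^r\subset P^{n+1}$: there is a smooth surjective submersion $\pi:V^{n-1}\to W$ such that at every point $p$ the hypersurface $V^{n-1}$ is tangent to the hypersphere with parameter $\pi(p)$. Let $\xi(w)$ be the polar hyperplane of $z(w)$ with respect to $Q^n$, and let $U^n\subset P^{n+1}$ be the envelope of the hyperplanes $\xi(w)$, that is, the union over $w\in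 W$ of their characteristics $\alpha(w)$, where $\alpha(w)$ consists of the points that satisfy the equation of $\xi(w)$ and its first derivatives with respect to the parameters. Theorem 5. (1) Each $\alpha(w)$ is a plane of dimension $m+1$, the polar, with respect to $Q^n$, of the tangent subspace of $U^r$ at $z(w)$. These planes depend smoothly on $w$, and $U^n$ is their union. (2) The planes $\alpha(w)$ sweep out a tangentially degenerate hypersurface of rank $r$. That is, in the parametrization $(w,t)\mapsto\big[\sum_i t_i a_i(w)\big]$ by any smooth local frame $a_0,\dots,a_{m+1}$ of the planes $\alpha(w)$, the regular points (those at which the tangent subspace of $U^n$ is a hyperplane of $P^{n+1}$) are dense, also in each single plane $\alpha(w)$, and at the regular points the Gauss map, which sends a point to the tangent hyperplane of $U^n$ there, is a smooth map of rank $r<n$ into the dual projective space. (3) At every regular point of $\alpha(w)$ the tangent hyperplane of $U^n$ is $\xi(w)$. Thus the $\xi(w)$ envelop $U^n$, whose tangent hyperplane is constant along each plane generator $\alpha(w)$. -/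

import Mathlib

open scoped Manifold ContDiff LinearAlgebra.Projectivization

noncomputable section

/-! ### Smooth maps into a real projective space

Smooth maps into `ℙ ℝ E` are handled through homogeneous coordinates, that is, through local smooth
lifts to `E` minus the origin. Planes of projective dimension `k` are linear subspaces of `E` of
dimension `k + 1`; a smooth map has rank `k` at a point if its projective tangent subspace there
has dimension `k`. -/

section Projective

variable {E : Type*} [NormedAddCommGroup E] [NormedSpace ℝ E]
  {B : Type*} [NormedAddCommGroup B] [NormedSpace ℝ B]
  {H : Type*} [TopologicalSpace H] (I : ModelWithCorners ℝ B H)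
  {M : Type*} [TopologicalSpace M] [ChartedSpace H M]

/-- The linear span of the vector `F p` and of all derivatives of `F` at `p`: the projective tangent
subspace at `p` of the map with homogeneous coordinates `F`. -/
def homogeneousTangent (F : M → E) (p : M) : Submodule ℝ E :=
  Submodule.span ℝ ({F p} ∪ Set.range (mvfderiv I F p))

/-- `Z` is a smooth choice of homogeneous coordinates for `z : M → ℙ ℝ E` on the open set `O`. -/
structure IsSmoothLiftOn (z : M → ℙ ℝ E) (O : Set M) (Z : M → E) : Prop where
  isOpen : IsOpen O
  smooth : ContMDiffOn I 𝓘(ℝ, E) ∞ Z O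
  lift : ∀ p ∈ O, ∃ h : Z p ≠ 0, Projectivization.mk ℝ (Z p) h = z p

/-- Smooth maps into the projective space. -/
def IsSmoothProjective (z : M → ℙ ℝ E) : Prop :=
  ∀ p, ∃ (O : Set M) (Z : M → E), p ∈ O ∧ IsSmoothLiftOn I z O Z

/-- The projective tangent subspace at `p` of a smooth map `z` into the projective space. All smooth
lifts of `z` near `p` yield the same subspace, so that the supremum is over equal subspaces. -/
def projectiveTangent (z : M → ℙ ℝ E) (p : M) : Submodule ℝ E :=
  ⨆ (O : Set M) (Z : M → E) (_ : IsSmoothLiftOn I z O Z) (_ : p ∈ O), homogeneousTangent I Z p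

/-! ### Families of hyperplanes and their envelopes -/

/-- `G` is a smooth choice of tangential coordinates, on the open set `O`, for the family `ξ` of
hyperplanes: the hyperplane `ξ p` has the equation `G p y = 0`. -/
structure IsSmoothEquationOn (ξ : M → Submodule ℝ E) (O : Set M) (G : M → (E →L[ℝ] ℝ)) : Prop where
  isOpen : IsOpen O
  smooth : ContMDiffOn I 𝓘(ℝ, E →L[ℝ] ℝ) ∞ G O
  ne_zero : ∀ p ∈ O, G p ≠ 0
  mem_iff : ∀ p ∈ O, ∀ y, y ∈ ξ p ↔ G p y = 0

/-- The characteristic at `p` of a smooth family `ξ` of hyperplanes: all `y` that satisfy the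
equation `G p y = 0` of the hyperplane `ξ p` together with its derivatives `dG p y = 0` with respect
to the parameters. All smooth equations `G` of the family near `p` yield the same subspace. -/
def characteristic (ξ : M → Submodule ℝ E) (p : M) : Submodule ℝ E :=
  ⨅ (O : Set M) (G : M → (E →L[ℝ] ℝ)) (_ : IsSmoothEquationOn I ξ O G) (_ : p ∈ O)
    (g : E →L[ℝ] ℝ) (_ : g ∈ homogeneousTangent I G p), LinearMap.ker (g : E →ₗ[ℝ] ℝ)

/-- The envelope of a smooth family of hyperplanes: the union of its characteristics. -/
def hyperplaneEnvelope (ξ : M → Submodule ℝ E) : Set (ℙ ℝ E) :=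
  {y | ∃ p, y.submodule ≤ characteristic I ξ p}

/-! ### Tangentially degenerate hypersurfaces -/

/-- `p` is a regular point of the hypersurface with homogeneous coordinates `F`: the tangent subspace
at `p` is a hyperplane. -/
def IsRegularHypersurfacePoint (F : M → E) (p : M) : Prop :=
  F p ≠ 0 ∧ Module.finrank ℝ (homogeneousTangent I F p) + 1 = Module.finrank ℝ E

/-- The Gauss map, which sends each point near `p` to its tangent hyperplane, is a smooth map of
rank `r` at `p` into the dual projective space. -/
def HasGaussRankAt (F : M → E) (p : M) (r : ℕ) : Prop :=
  ∃ (O : Set M) (G : M → (E →L[ℝ] ℝ)), p ∈ O ∧ IsSmoothEquationOn I (homogeneousTangent I F) O G ∧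
    Module.finrank ℝ (homogeneousTangent I G p) = r + 1

/-- The map with homogeneous coordinates `F`, defined on the open set `S`, parametrizes a tangentially
degenerate hypersurface of rank `r`: it is smooth, almost all of its points are regular, and at the
regular points the Gauss map has rank `r`, less than the dimension of the hypersurface (which is
`dim E - 2`). -/
structure IsTangentiallyDegenerateOn (F : M → E) (S : Set M) (r : ℕ) : Prop where
  isOpen : IsOpen S
  smooth : ContMDiffOn I 𝓘(ℝ, E) ∞ F S
  regular_dense : S ⊆ closure {p ∈ S | IsRegularHypersurfacePoint I F p}
  gauss_rank : ∀ p ∈ S, IsRegularHypersurfacePoint I F p → HasGaussRankAt I F p r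
  rank_lt : r + 2 < Module.finrank ℝ E

/-- On the open set `O`, the points `a p 0, …, a p (k - 1)` depend smoothly on `p` and form a basis
of the plane `α p`. -/
structure IsSmoothFrameOn (α : M → Submodule ℝ E) (O : Set M) {k : ℕ} (a : M → Fin k → E) :
    Prop where
  isOpen : IsOpen O
  smooth : ∀ i, ContMDiffOn I 𝓘(ℝ, E) ∞ (fun p => a p i) O
  linearIndependent : ∀ p ∈ O, LinearIndependent ℝ (a p)
  span : ∀ p ∈ O, Submodule.span ℝ (Set.range (a p)) = α p

/-- The variety swept out by the planes spanned by the points `a p i`, in homogeneous coordinates: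
the point `∑ tᵢ aᵢ(p)` of the plane with parameter `p`. -/
def sweep {k : ℕ} (a : M → Fin k → E) (q : M × (Fin k → ℝ)) : E :=
  ∑ i, q.2 i • a q.1 i

end Projective

/-! ### The conformal space, the Darboux hyperquadric and canal hypersurfaces -/

/-- The conformal space `Cⁿ`: the unit sphere of `ℝⁿ⁺¹`. -/
abbrev ConformalSpace (n : ℕ) : Type :=
  Metric.sphere (0 : EuclideanSpace ℝ (Fin (n + 1))) 1

/-- The vector space `ℝⁿ⁺²` of polyspherical coordinates; its projective space is `Pⁿ⁺¹`. -/
abbrev Polyspherical (n : ℕ) : Type := EuclideanSpace ℝ (Fin (n + 1)) × ℝ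

/-- The fundamental form, of signature `(n + 1, 1)`; its null points form the Darboux hyperquadric. -/
def darbouxForm (n : ℕ) : LinearMap.BilinForm ℝ (Polyspherical n) :=
  LinearMap.mk₂ ℝ (fun X Y => inner ℝ X.1 Y.1 - X.2 * Y.2)
    (fun X X' Y => by simp only [Prod.fst_add, Prod.snd_add, inner_add_left]; ring)
    (fun c X Y => by
      simp only [Prod.smul_fst, Prod.smul_snd, real_inner_smul_left, smul_eq_mul]; ring)
    (fun X Y Y' => by simp only [Prod.fst_add, Prod.snd_add, inner_add_right]; ring)
    (fun c X Y => by
      simp only [Prod.smul_fst, Prod.smul_snd, real_inner_smul_right, smul_eq_mul]; ring)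

/-- The polar subspace of a plane with respect to the Darboux hyperquadric. -/
def polar {n : ℕ} (T : Submodule ℝ (Polyspherical n)) : Submodule ℝ (Polyspherical n) :=
  (darbouxForm n).orthogonal T

/-- The Darboux mapping on points, in homogeneous coordinates: it maps `Cⁿ` bijectively onto the
Darboux hyperquadric. -/
def darbouxPoint {n : ℕ} (s : ConformalSpace n) : Polyspherical n := (s, 1)

/-- The points of `Pⁿ⁺¹` outside the Darboux hyperquadric, which are the images of the
hyperspheres of `Cⁿ` under the Darboux mapping. -/
def IsOutside {n : ℕ} (ζ : ℙ ℝ (Polyspherical n)) : Prop :=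
  0 < darbouxForm n ζ.rep ζ.rep

/-- The hypersphere of `Cⁿ` whose image under the Darboux mapping is `ζ = [a : b]`: all points `s` of
the conformal space with `⟪a, s⟫ = b`. -/
def hypersphere {n : ℕ} (ζ : ℙ ℝ (Polyspherical n)) : Set (ConformalSpace n) :=
  {s | darbouxPoint s ∈ polar ζ.submodule}

/-- The polar hyperplanes of the points `z w` with respect to the Darboux hyperquadric. -/
def polarFamily {n : ℕ} {W : Type*} (z : W → ℙ ℝ (Polyspherical n)) (w : W) :
    Submodule ℝ (Polyspherical n) :=
  polar (z w).submodule

/-- The map `x` into the conformal space touches the hypersphere with image `ζ` at the parameter `p`: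
the point `x p` lies on the hypersphere, and the differential of `x` at `p` takes its values in the
tangent space of the hypersphere. -/
def Touches {n : ℕ} (d : ℕ) {V : Type*} [TopologicalSpace V] [ChartedSpace (EuclideanSpace ℝ (Fin d)) V]
    (x : V → ConformalSpace n) (p : V) (ζ : ℙ ℝ (Polyspherical n)) : Prop :=
  x p ∈ hypersphere ζ ∧ ∀ v : TangentSpace (𝓡 d) p,
    mvfderiv (𝓡 d) (fun q => darbouxPoint (x q)) p v ∈ polar ζ.submodule

/-- The immersed hypersurface `x : V → Cⁿ` is an `m`-canal hypersurface: for `r = n - m - 1`, where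
`1 ≤ r` and `1 ≤ m`, it is the envelope of the `r`-parameter family of hyperspheres whose images under
the Darboux mapping are the points `z w`. The family depends smoothly and essentially on its `r`
parameters, `V` touches at `p` the hypersphere with parameter `π p`, each hypersphere of the family is
touched, and the contact hypersphere depends on exactly `r` parameters also as `p` varies in `V`. -/
structure IsCanalHypersurface (n m r : ℕ)
    {V : Type*} [TopologicalSpace V] [ChartedSpace (EuclideanSpace ℝ (Fin (n - 1))) V]
    {W : Type*} [TopologicalSpace W] [ChartedSpace (EuclideanSpace ℝ (Fin r)) W]
    (x : V → ConformalSpace n) (z : W → ℙ ℝ (Polyspherical n)) (π : V → W) : Prop where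
  one_le_m : 1 ≤ m
  one_le_r : 1 ≤ r
  dim : n = m + r + 1
  smooth : ContMDiff (𝓡 (n - 1)) (𝓡 n) ∞ x
  immersion : ∀ p, Function.Injective (mfderiv (𝓡 (n - 1)) (𝓡 n) x p)
  smooth_family : IsSmoothProjective (𝓡 r) z
  outside : ∀ w, IsOutside (z w)
  rank_family : ∀ w, Module.finrank ℝ (projectiveTangent (𝓡 r) z w) = r + 1
  smooth_param : ContMDiff (𝓡 (n - 1)) (𝓡 r) ∞ π
  submersion : ∀ p, Function.Surjective (mfderiv (𝓡 (n - 1)) (𝓡 r) π p)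
  surjective : Function.Surjective π
  touches : ∀ p, Touches (n - 1) x p (z (π p))

/-- The generator with parameter `w` of the envelope of the polar hyperplanes of the points `z w`: the
characteristic of this family of hyperplanes. -/
def generator {n : ℕ} (r : ℕ) {W : Type*} [TopologicalSpace W]
    [ChartedSpace (EuclideanSpace ℝ (Fin r)) W] (z : W → ℙ ℝ (Polyspherical n)) (w : W) :
    Submodule ℝ (Polyspherical n) :=
  characteristic (𝓡 r) (polarFamily z) w

end

/-! The argument is projective duality for a family of hyperplanes `ξ p = ker (G p)` whose tangential
coordinates `G` have rank `r`. The characteristic `α p` is the annihilator of the tangent space of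
`G` at `p`. Differentiating `G p y = 0` along a point `y` that moves with `α p` shows that the
tangent space of the swept variety along `α p` lies in `ξ p`; at a regular point it is therefore
equal to `ξ p`, and the Gauss map factors through `p ↦ ξ p`. Along one `α p`, the tangent space at
the point with coordinates `t` is the range of a linear map depending affinely on `t`, so a single
regular point in `α p` makes regular points dense there.

For a canal hypersurface such a point comes from the contact points `X p = (x p, 1)`, which lie in
`α (π p)`. The tangent space of `X` at `p` has codimension two and lies, like `α (π p)`, in the
tangent space of the swept variety at `X p`. Hence `X p` is regular unless `α (π p)` lies in the
tangent space of `X`, and so in the polar of `X p`. Then, by duality, `X p` would lie in the tangent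
space of the family `z` at `π p` and be conjugate to every `X q` with `π q = π p`. Distinct points
of the Darboux hyperquadric are never conjugate, so `x` would be constant on the fibre of `π`
through `p`; this is impossible for an immersion, as the fibre has dimension `m ≥ 1`. -/

open Module Filter Topology

/-! ### Projective tangent subspaces -/

section HomogeneousTangent

variable {E : Type*} [NormedAddCommGroup E] [NormedSpace ℝ E]
  {E' : Type*} [NormedAddCommGroup E'] [NormedSpace ℝ E']
  {B : Type*} [NormedAddCommGroup B] [NormedSpace ℝ B]
  {H : Type*} [TopologicalSpace H] {I : ModelWithCorners ℝ B H}
  {M : Type*} [TopologicalSpace M] [ChartedSpace H M]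
  {B' : Type*} [NormedAddCommGroup B'] [NormedSpace ℝ B']
  {H' : Type*} [TopologicalSpace H'] {J : ModelWithCorners ℝ B' H'}
  {N : Type*} [TopologicalSpace N] [ChartedSpace H' N]

theorem mvfderiv_vector_comp_apply {f : M → E} {g : N → M} {q : N}
    (hf : MDifferentiableAt I 𝓘(ℝ, E) f (g q)) (hg : MDifferentiableAt J I g q)
    (v : TangentSpace J q) :
    mvfderiv J (f ∘ g) q v = mvfderiv I f (g q) (mfderiv J I g q v) :=
  mfderiv_comp_apply q hf hg v

theorem mvfderiv_congr {f g : M → E} {p : M} (h : f =ᶠ[𝓝 p] g) :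
    mvfderiv I f p = mvfderiv I g p := by
  ext v
  exact congr($(h.mfderiv_eq (I := I) (I' := 𝓘(ℝ, E))) v)

theorem mvfderiv_clm_apply {A : M → E →L[ℝ] E'} {y : M → E} {p : M}
    (hA : MDifferentiableAt I 𝓘(ℝ, E →L[ℝ] E') A p) (hy : MDifferentiableAt I 𝓘(ℝ, E) y p)
    (v : TangentSpace I p) :
    mvfderiv I (fun q => A q (y q)) p v = A p (mvfderiv I y p v) + mvfderiv I A p v (y p) := by
  rw [(hA.clm_apply hy).mvfderiv, hA.mvfderiv, hy.mvfderiv]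
  set φ := extChartAt I p with hφ
  have key : fderivWithin ℝ (fun u => A (φ.symm u) (y (φ.symm u))) (Set.range I) (φ p) =
      (A (φ.symm (φ p))).comp (fderivWithin ℝ (y ∘ φ.symm) (Set.range I) (φ p)) +
        (fderivWithin ℝ (A ∘ φ.symm) (Set.range I) (φ p)).flip (y (φ.symm (φ p))) :=
    fderivWithin_clm_apply (I.uniqueDiffOn _ (Set.mem_range_self _))
      ((mdifferentiableAt_iff A p).1 hA).2 ((mdifferentiableAt_iff y p).1 hy).2
  rw [hφ, extChartAt_to_inv] at key
  exact congr($key v)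

theorem mvfderiv_clm_comp (L : E →L[ℝ] E') {f : M → E} {p : M}
    (hf : MDifferentiableAt I 𝓘(ℝ, E) f p) (v : TangentSpace I p) :
    mvfderiv I (fun q => L (f q)) p v = L (mvfderiv I f p v) := by
  rw [mvfderiv_clm_apply mdifferentiableAt_const hf, mvfderiv_const]
  simp

theorem mvfderiv_eq_fderiv (f : B → E) (u : B) : mvfderiv 𝓘(ℝ, B) f u = fderiv ℝ f u := by
  ext v
  exact congr($(mfderiv_eq_fderiv (f := f) (x := u)) v)

theorem homogeneousTangent_eq_sup (F : M → E) (p : M) :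
    homogeneousTangent I F p =
      Submodule.span ℝ {F p} ⊔ LinearMap.range (mvfderiv I F p : TangentSpace I p →ₗ[ℝ] E) := by
  rw [homogeneousTangent, Submodule.span_union]
  exact congrArg _ (Submodule.span_eq (LinearMap.range _))

theorem mem_homogeneousTangent_self (F : M → E) (p : M) : F p ∈ homogeneousTangent I F p :=
  Submodule.subset_span (Or.inl rfl)

theorem mvfderiv_mem_homogeneousTangent (F : M → E) (p : M) (v : TangentSpace I p) :
    mvfderiv I F p v ∈ homogeneousTangent I F p :=
  Submodule.subset_span (Or.inr ⟨v, rfl⟩)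

theorem homogeneousTangent_le_iff {F : M → E} {p : M} {S : Submodule ℝ E} :
    homogeneousTangent I F p ≤ S ↔ F p ∈ S ∧ ∀ v, mvfderiv I F p v ∈ S := by
  rw [homogeneousTangent, Submodule.span_le, Set.union_subset_iff, Set.singleton_subset_iff,
    Set.range_subset_iff]
  rfl

theorem homogeneousTangent_congr {f g : M → E} {p : M} (h : f =ᶠ[𝓝 p] g) :
    homogeneousTangent I f p = homogeneousTangent I g p := by
  rw [homogeneousTangent, homogeneousTangent, mvfderiv_congr h, h.eq_of_nhds]

theorem homogeneousTangent_clm_comp (L : E →L[ℝ] E') {f : M → E} {p : M}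
    (hf : MDifferentiableAt I 𝓘(ℝ, E) f p) :
    homogeneousTangent I (fun q => L (f q)) p =
      (homogeneousTangent I f p).map (L : E →ₗ[ℝ] E') := by
  rw [homogeneousTangent, homogeneousTangent, Submodule.map_span, Set.image_union,
    Set.image_singleton, ← Set.range_comp]
  congr 3
  ext1 v
  exact mvfderiv_clm_comp L hf v

theorem homogeneousTangent_comp_le {f : M → E} {g : N → M} {q : N}
    (hf : MDifferentiableAt I 𝓘(ℝ, E) f (g q)) (hg : MDifferentiableAt J I g q) :
    homogeneousTangent J (f ∘ g) q ≤ homogeneousTangent I f (g q) := by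
  refine homogeneousTangent_le_iff.2 ⟨mem_homogeneousTangent_self f (g q), fun v => ?_⟩
  rw [mvfderiv_vector_comp_apply hf hg]
  exact mvfderiv_mem_homogeneousTangent _ _ _

theorem homogeneousTangent_comp_of_surjective {f : M → E} {g : N → M} {q : N}
    (hf : MDifferentiableAt I 𝓘(ℝ, E) f (g q)) (hg : MDifferentiableAt J I g q)
    (hs : Function.Surjective (mfderiv J I g q)) :
    homogeneousTangent J (f ∘ g) q = homogeneousTangent I f (g q) := by
  refine (homogeneousTangent_comp_le hf hg).antisymm
    (homogeneousTangent_le_iff.2 ⟨mem_homogeneousTangent_self (f ∘ g) q, fun v => ?_⟩)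
  obtain ⟨v, rfl⟩ := hs v
  rw [← mvfderiv_vector_comp_apply hf hg]
  exact mvfderiv_mem_homogeneousTangent _ _ _

theorem homogeneousTangent_le_of_proportional {F F' : M → E} {p : M}
    (hF : MDifferentiableAt I 𝓘(ℝ, E) F p) (hF' : MDifferentiableAt I 𝓘(ℝ, E) F' p)
    (h0 : F p ≠ 0) (h : ∀ᶠ q in 𝓝 p, ∃ c : ℝ, F' q = c • F q) :
    homogeneousTangent I F' p ≤ homogeneousTangent I F p := by
  obtain ⟨φ, -, hφ⟩ := exists_dual_vector ℝ (F p) (by simpa using h0)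
  have hφ0 : φ (F p) ≠ 0 := by rw [hφ]; simpa using h0
  have hφF : MDifferentiableAt I 𝓘(ℝ, ℝ) (fun q => φ (F q)) p :=
    φ.differentiableAt.mdifferentiableAt.comp p hF
  have hφF' : MDifferentiableAt I 𝓘(ℝ, ℝ) (fun q => φ (F' q)) p :=
    φ.differentiableAt.mdifferentiableAt.comp p hF'
  have cross : (fun q => φ (F q) • F' q) =ᶠ[𝓝 p] fun q => φ (F' q) • F q := by
    filter_upwards [h] with q ⟨c, hc⟩
    simp [hc, smul_smul, mul_comm]
  obtain ⟨c, hc⟩ := h.self_of_nhds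
  have hF'p : F' p ∈ homogeneousTangent I F p := by
    rw [hc]
    exact Submodule.smul_mem _ _ (mem_homogeneousTangent_self F p)
  refine homogeneousTangent_le_iff.2 ⟨hF'p, fun v => (Submodule.smul_mem_iff _ hφ0).1 ?_⟩
  have hd := congr($(mvfderiv_congr (I := I) cross) v)
  rw [mvfderiv_fun_smul hφF hF', mvfderiv_fun_smul hφF' hF] at hd
  simp only [add_apply, smul_apply, ContinuousLinearMap.smulRight_apply] at hd
  rw [eq_sub_of_add_eq hd]
  exact sub_mem (add_mem (Submodule.smul_mem _ _ (mvfderiv_mem_homogeneousTangent F p v))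
    (Submodule.smul_mem _ _ (mem_homogeneousTangent_self F p))) (Submodule.smul_mem _ _ hF'p)

theorem finrank_homogeneousTangent [FiniteDimensional ℝ E] {F : M → E} {p : M}
    (hinj : Function.Injective (mvfderiv I F p)) (hF : F p ∉ Set.range (mvfderiv I F p)) :
    finrank ℝ (homogeneousTangent I F p) = finrank ℝ B + 1 := by
  rw [homogeneousTangent_eq_sup, sup_comm, Submodule.finrank_sup_span_singleton hF,
    LinearMap.finrank_range_of_inj hinj]
  rfl

variable [I.Boundaryless] [IsManifold I ∞ M]

/-- In a chart, the projective tangent subspaces are the ranges of the linear maps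
`(c, v) ↦ c • F q + dF v`. -/
theorem exists_contMDiffOn_range_eq_homogeneousTangent {F : M → E} {O : Set M} (hO : IsOpen O)
    (hF : ContMDiffOn I 𝓘(ℝ, E) ∞ F O) {p : M} (hp : p ∈ O) :
    ∃ U ⊆ O, IsOpen U ∧ p ∈ U ∧ ∃ L : M → (ℝ × B →L[ℝ] E),
      ContMDiffOn I 𝓘(ℝ, ℝ × B →L[ℝ] E) ∞ L U ∧
      ∀ q ∈ U, LinearMap.range (L q : ℝ × B →ₗ[ℝ] E) = homogeneousTangent I F q := by
  set φ := extChartAt I p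
  have hφs : IsOpen φ.source := isOpen_extChartAt_source p
  have hT : IsOpen (φ.target ∩ φ.symm ⁻¹' O) :=
    (contMDiffOn_extChartAt_symm (n := ∞) p).continuousOn.isOpen_inter_preimage
      (isOpen_extChartAt_target p) hO
  have hf : ContDiffOn ℝ ∞ (F ∘ φ.symm) (φ.target ∩ φ.symm ⁻¹' O) :=
    contMDiffOn_iff_contDiffOn.1 (hF.comp ((contMDiffOn_extChartAt_symm p).mono
      Set.inter_subset_left) Set.inter_subset_right)
  have hmaps : Set.MapsTo φ (O ∩ φ.source) (φ.target ∩ φ.symm ⁻¹' O) := fun q hq =>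
    ⟨φ.map_source hq.2, by simpa only [Set.mem_preimage, φ.left_inv hq.2] using hq.1⟩
  have hφU : ContMDiffOn I 𝓘(ℝ, B) ∞ φ (O ∩ φ.source) :=
    (contMDiffOn_extChartAt (x := p)).mono fun q hq => by simpa [φ] using hq.2
  refine ⟨O ∩ φ.source, Set.inter_subset_left, hO.inter hφs, ⟨hp, mem_extChartAt_source p⟩,
    fun q => (ContinuousLinearMap.toSpanSingleton ℝ (F q)).coprod
      (fderiv ℝ (F ∘ φ.symm) (φ q)), ?_, fun q hq => ?_⟩
  · have hd : ContMDiffOn I 𝓘(ℝ, B →L[ℝ] E) ∞ (fun q => fderiv ℝ (F ∘ φ.symm) (φ q))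
        (O ∩ φ.source) :=
      (contMDiffOn_iff_contDiffOn.2 (hf.fderiv_of_isOpen hT le_rfl)).comp hφU hmaps
    have hs : ContMDiffOn I 𝓘(ℝ, ℝ →L[ℝ] E) ∞
        (fun q => ContinuousLinearMap.toSpanSingleton ℝ (F q)) (O ∩ φ.source) :=
      (ContinuousLinearMap.toSpanSingletonCLE (𝕜 := ℝ) (E := E)).contDiff.contMDiff.comp_contMDiffOn
        (hF.mono Set.inter_subset_left)
    exact (ContinuousLinearMap.coprodEquivL ℝ).contDiff.contMDiff.comp_contMDiffOn
      (hs.prodMk_space hd)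
  · have hFφ : F =ᶠ[𝓝 q] (F ∘ φ.symm) ∘ φ := by
      filter_upwards [hφs.mem_nhds hq.2] with q' hq'
      simp [φ.left_inv hq']
    have hdf : MDifferentiableAt 𝓘(ℝ, B) 𝓘(ℝ, E) (F ∘ φ.symm) (φ q) :=
      ((hf.contDiffAt (hT.mem_nhds (hmaps hq))).differentiableAt (by simp)).mdifferentiableAt
    rw [homogeneousTangent_congr hFφ, homogeneousTangent_comp_of_surjective hdf
      (mdifferentiableAt_extChartAt (by simpa [φ] using hq.2))
      (isInvertible_mfderiv_extChartAt hq.2).bijective.surjective, homogeneousTangent_eq_sup,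
      ContinuousLinearMap.coe_coprod, LinearMap.range_coprod,
      mvfderiv_eq_fderiv, hFφ.eq_of_nhds]
    exact congrArg₂ _ (LinearMap.range_toSpanSingleton _) rfl

theorem eventually_le_finrank_homogeneousTangent [FiniteDimensional ℝ E] {F : M → E} {O : Set M}
    (hO : IsOpen O) (hF : ContMDiffOn I 𝓘(ℝ, E) ∞ F O) {p : M} (hp : p ∈ O) {k : ℕ}
    (hk : k ≤ finrank ℝ (homogeneousTangent I F p)) :
    ∀ᶠ q in 𝓝 p, k ≤ finrank ℝ (homogeneousTangent I F q) := by
  obtain ⟨U, -, hU, hpU, L, hL, hrange⟩ := exists_contMDiffOn_range_eq_homogeneousTangent hO hF hp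
  have hrank : ∀ q ∈ U, (k ≤ finrank ℝ (homogeneousTangent I F q) ↔
      (k : Cardinal) ≤ (L q : ℝ × B →ₗ[ℝ] E).rank) := fun q hq => by
    rw [← hrange q hq, LinearMap.rank, ← finrank_eq_rank, Nat.cast_le]
  have hopen := ((hL.continuousOn.continuousAt (hU.mem_nhds hpU)).eventually
    ((isOpen_setOfPred_nat_le_rank k).mem_nhds ((hrank p hpU).1 hk)))
  filter_upwards [hopen, hU.mem_nhds hpU] with q hq hqU using (hrank q hqU).2 hq

end HomogeneousTangent

/-! ### Linear algebra -/

section LinearFamilies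

variable {S P Q : Type*} [AddCommGroup P] [Module ℝ P] [AddCommGroup Q] [Module ℝ Q]

theorem exists_comp_comp_eq_id {k : ℕ} (A : P →ₗ[ℝ] Q) (hk : k ≤ finrank ℝ (LinearMap.range A)) :
    ∃ (ι : (Fin k → ℝ) →ₗ[ℝ] P) (ρ : Q →ₗ[ℝ] (Fin k → ℝ)), ρ ∘ₗ A ∘ₗ ι = LinearMap.id := by
  obtain ⟨y, hy⟩ := exists_linearIndependent_of_le_finrank hk
  choose x hx using fun i => (y i).2
  have hAι : LinearMap.ker (A ∘ₗ Fintype.linearCombination ℝ x) = ⊥ := by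
    have hcomp : A ∘ₗ Fintype.linearCombination ℝ x =
        Fintype.linearCombination ℝ fun i => (y i : Q) := by
      ext i
      simp [hx]
    rw [hcomp, LinearMap.ker_eq_bot,
      ← linearIndependent_iff_injective_fintypeLinearCombination]
    exact hy.map' _ (Submodule.ker_subtype _)
  obtain ⟨ρ, hρ⟩ := LinearMap.exists_leftInverse_of_injective _ hAι
  exact ⟨_, ρ, hρ⟩

theorem finite_setOf_not_injective_lineMap_id [FiniteDimensional ℝ P] (A : End ℝ P) :
    {c : ℝ | ¬ Function.Injective (AffineMap.lineMap (1 : End ℝ P) A c)}.Finite := by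
  refine ((End.finite_hasEigenvalue A).image fun μ => (1 - μ)⁻¹).subset fun c hc => ?_
  obtain ⟨y, hy, hy0⟩ : ∃ y, AffineMap.lineMap (1 : End ℝ P) A c y = 0 ∧ y ≠ 0 := by
    simpa [injective_iff_map_eq_zero] using hc
  have hy' : c • A y = (c - 1) • y := by
    rw [AffineMap.lineMap_apply_module, LinearMap.add_apply] at hy
    rw [← neg_sub, neg_smul]
    exact eq_neg_of_add_eq_zero_right hy
  have hc0 : c ≠ 0 := by
    rintro rfl
    simp [hy0] at hy'
  refine ⟨(c - 1) / c, End.hasEigenvalue_of_hasEigenvector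
    ⟨End.mem_eigenspace_iff.2 ?_, hy0⟩, ?_⟩
  · rw [div_eq_inv_mul, mul_smul, ← hy', inv_smul_smul₀ hc0]
  · field_simp
    ring

theorem dense_setOf_le_finrank_range [AddCommGroup S] [Module ℝ S] [TopologicalSpace S]
    [IsTopologicalAddGroup S] [ContinuousSMul ℝ S] [FiniteDimensional ℝ Q]
    (Φ : S →ᵃ[ℝ] (P →ₗ[ℝ] Q)) {k : ℕ} {s₀ : S} (h : k ≤ finrank ℝ (LinearMap.range (Φ s₀))) :
    Dense {s | k ≤ finrank ℝ (LinearMap.range (Φ s))} := by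
  obtain ⟨ι, ρ, hid⟩ := exists_comp_comp_eq_id (Φ s₀) h
  intro s
  have hfin := finite_setOf_not_injective_lineMap_id (ρ ∘ₗ Φ s ∘ₗ ι)
  have hline : Continuous fun c : ℝ => AffineMap.lineMap s₀ s c := AffineMap.lineMap_continuous
  rw [← AffineMap.lineMap_apply_one (k := ℝ) s₀ s]
  refine map_mem_closure hline (hfin.countable.dense_compl ℝ 1) fun c hc => ?_
  have hinj : Function.Injective (ρ ∘ₗ Φ (AffineMap.lineMap s₀ s c) ∘ₗ ι) := by
    have hcomp : ρ ∘ₗ Φ (AffineMap.lineMap s₀ s c) ∘ₗ ι =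
        AffineMap.lineMap (1 : End ℝ (Fin k → ℝ)) (ρ ∘ₗ Φ s ∘ₗ ι) c := by
      rw [AffineMap.apply_lineMap, AffineMap.lineMap_apply_module, AffineMap.lineMap_apply_module,
        LinearMap.add_comp, LinearMap.comp_add, LinearMap.smul_comp, LinearMap.comp_smul,
        LinearMap.smul_comp, LinearMap.comp_smul, hid]
      rfl
    rw [hcomp]
    exact not_not.1 hc
  have hΦι : Function.Injective (Φ (AffineMap.lineMap s₀ s c) ∘ₗ ι) :=
    Function.Injective.of_comp (f := ρ) hinj
  calc k = finrank ℝ (LinearMap.range (Φ (AffineMap.lineMap s₀ s c) ∘ₗ ι)) := by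
        rw [LinearMap.finrank_range_of_inj hΦι, finrank_fin_fun]
    _ ≤ finrank ℝ (LinearMap.range (Φ (AffineMap.lineMap s₀ s c))) :=
        Submodule.finrank_mono (LinearMap.range_comp_le_range _ _)

end LinearFamilies

/-! ### Smooth frames -/

section FrameMap

variable {E : Type*} [NormedAddCommGroup E] [NormedSpace ℝ E] {M : Type*} {k : ℕ}

/-- The linear parametrization `t ↦ ∑ tᵢ aᵢ(p)` of the plane spanned by the points `a p i`. -/
def frameMap (a : M → Fin k → E) (p : M) : (Fin k → ℝ) →L[ℝ] E :=
  ∑ i, (ContinuousLinearMap.proj i).smulRight (a p i)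

theorem frameMap_apply (a : M → Fin k → E) (p : M) (t : Fin k → ℝ) :
    frameMap a p t = sweep a (p, t) := by
  simp [frameMap, sweep]

theorem sweep_eq_frameMap (a : M → Fin k → E) : sweep a = fun q => frameMap a q.1 q.2 :=
  funext fun q => (frameMap_apply a q.1 q.2).symm

theorem coe_frameMap (a : M → Fin k → E) (p : M) :
    (frameMap a p : (Fin k → ℝ) →ₗ[ℝ] E) = Fintype.linearCombination ℝ (a p) :=
  LinearMap.ext fun t => frameMap_apply a p t

end FrameMap

section Frames

variable {E : Type*} [NormedAddCommGroup E] [NormedSpace ℝ E]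
  {F : Type*} [NormedAddCommGroup F] [NormedSpace ℝ F]
  {B : Type*} [NormedAddCommGroup B] [NormedSpace ℝ B]
  {H : Type*} [TopologicalSpace H] {I : ModelWithCorners ℝ B H}
  {M : Type*} [TopologicalSpace M] [ChartedSpace H M]
  {B' : Type*} [NormedAddCommGroup B'] [NormedSpace ℝ B']
  {H' : Type*} [TopologicalSpace H'] {J : ModelWithCorners ℝ B' H'}
  {N : Type*} [TopologicalSpace N] [ChartedSpace H' N]
  {k : ℕ}

theorem exists_continuousLinearEquiv_range_prod_ker [FiniteDimensional ℝ E]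
    [FiniteDimensional ℝ F] (A : E →L[ℝ] F) :
    ∃ (ρ : F →L[ℝ] LinearMap.range (A : E →ₗ[ℝ] F)) (κ : E →L[ℝ] LinearMap.ker (A : E →ₗ[ℝ] F))
      (e : E ≃L[ℝ] LinearMap.range (A : E →ₗ[ℝ] F) × LinearMap.ker (A : E →ₗ[ℝ] F)),
      (ρ ∘L A).prod κ = e := by
  obtain ⟨ρ, hρ⟩ := (LinearMap.range (A : E →ₗ[ℝ] F)).subtype.exists_leftInverse_of_injective
    (Submodule.ker_subtype _)
  obtain ⟨κ, hκ⟩ := (LinearMap.ker (A : E →ₗ[ℝ] F)).subtype.exists_leftInverse_of_injective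
    (Submodule.ker_subtype _)
  have hinj : Function.Injective
      ((ρ ∘ₗ (A : E →ₗ[ℝ] F)).prod κ) := (injective_iff_map_eq_zero _).2 fun y hy => by
    have hAy : A y = 0 := by
      have h := congr($hρ ⟨A y, LinearMap.mem_range_self _ y⟩)
      exact congrArg Subtype.val (h.symm.trans (congrArg Prod.fst hy))
    have h := congr($hκ ⟨y, hAy⟩)
    exact congrArg Subtype.val (h.symm.trans (congrArg Prod.snd hy))
  refine ⟨ρ.toContinuousLinearMap, κ.toContinuousLinearMap,
    (LinearEquiv.ofInjectiveOfFinrankEq _ hinj ?_).toContinuousLinearEquiv, ?_⟩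
  · rw [finrank_prod, LinearMap.finrank_range_add_finrank_ker]
  · ext1 y
    rfl

theorem span_range_inverse_prod_eq_ker [FiniteDimensional ℝ E] {R K : Type*}
    [NormedAddCommGroup R] [NormedSpace ℝ R] [NormedAddCommGroup K] [NormedSpace ℝ K]
    {A : E →L[ℝ] F} {ρ : F →L[ℝ] R} {κ : E →L[ℝ] K} {e : E ≃L[ℝ] R × K} (he : (ρ ∘L A).prod κ = e)
    (hk : finrank ℝ (LinearMap.ker (A : E →ₗ[ℝ] F)) = k) (b : Basis (Fin k) ℝ K) :
    LinearIndependent ℝ (fun i => e.symm (0, b i)) ∧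
      Submodule.span ℝ (Set.range fun i => e.symm (0, b i)) = LinearMap.ker (A : E →ₗ[ℝ] F) := by
  have hli : LinearIndependent ℝ (fun i => e.symm (0, b i)) :=
    b.linearIndependent.map' (e.symm.toLinearMap ∘ₗ LinearMap.inr ℝ R K)
      (LinearMap.ker_eq_bot.2 (e.symm.injective.comp LinearMap.inr_injective))
  refine ⟨hli, (Submodule.eq_of_le_of_finrank_eq (fun y hy => ?_) ?_).symm⟩
  · have hy' : y = (e.symm.toLinearMap ∘ₗ LinearMap.inr ℝ R K) (κ y) := by
      have h : e y = (0, κ y) := by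
        rw [← ContinuousLinearEquiv.coe_coe, ← he]
        simp [show A y = 0 from hy]
      simp [← h]
    have hrange : Set.range (fun i => e.symm (0, b i)) =
        (e.symm.toLinearMap ∘ₗ LinearMap.inr ℝ R K) '' Set.range b :=
      Set.range_comp (e.symm.toLinearMap ∘ₗ LinearMap.inr ℝ R K) b
    rw [hrange, Submodule.span_image, b.span_eq, hy']
    exact Submodule.mem_map_of_mem Submodule.mem_top
  · rw [finrank_span_eq_card hli, Fintype.card_fin, hk]

theorem exists_isSmoothFrameOn_ker_of_prod_eq [FiniteDimensional ℝ E] {R K : Type*}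
    [NormedAddCommGroup R] [NormedSpace ℝ R] [NormedAddCommGroup K] [NormedSpace ℝ K]
    {A : M → E →L[ℝ] F} {O : Set M}
    (hO : IsOpen O) (hA : ContMDiffOn I 𝓘(ℝ, E →L[ℝ] F) ∞ A O)
    (hk : ∀ q ∈ O, finrank ℝ (LinearMap.ker (A q : E →ₗ[ℝ] F)) = k) {p : M} (hp : p ∈ O)
    {ρ : F →L[ℝ] R} {κ : E →L[ℝ] K} {e₀ : E ≃L[ℝ] R × K} (he₀ : (ρ ∘L A p).prod κ = e₀)
    (b : Basis (Fin k) ℝ K) :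
    ∃ U ⊆ O, p ∈ U ∧ ∃ a : M → Fin k → E,
      IsSmoothFrameOn I (fun q => LinearMap.ker (A q : E →ₗ[ℝ] F)) U a := by
  have : CompleteSpace E := FiniteDimensional.complete ℝ E
  set Φ : M → E →L[ℝ] R × K := fun q => (ρ ∘L A q).prod κ
  have hΦs : ContMDiffOn I 𝓘(ℝ, E →L[ℝ] R × K) ∞ Φ O :=
    (ContinuousLinearMap.prodL (E := E) (F := R) (G := K) ℝ).contDiff.contMDiff.comp_contMDiffOn
      (ContMDiffOn.prodMk_space (f := fun q => ρ ∘L A q) (g := fun _ => κ)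
        (contMDiffOn_const.clm_comp hA) contMDiffOn_const)
  have hframe : ∀ q, ∀ e : E ≃L[ℝ] R × K, Φ q = e →
      (fun i => (Φ q).inverse (0, b i)) = fun i => e.symm (0, b i) := fun q e he => by
    ext1 i
    rw [he, ContinuousLinearMap.inverse_equiv]
    rfl
  refine ⟨O ∩ Φ ⁻¹' Set.range ((↑) : (E ≃L[ℝ] R × K) → (E →L[ℝ] R × K)), Set.inter_subset_left,
    ⟨hp, e₀, he₀.symm⟩, fun q i => (Φ q).inverse (0, b i),
    hΦs.continuousOn.isOpen_inter_preimage hO ContinuousLinearEquiv.isOpen,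
    fun i q ⟨hq, e, he⟩ => ?_, fun q ⟨hq, e, he⟩ => ?_, fun q ⟨hq, e, he⟩ => ?_⟩
  · have hinv : ContDiffAt ℝ ∞ ContinuousLinearMap.inverse (Φ q) := by
      rw [← he]
      exact contDiffAt_map_inverse e
    exact ((hinv.contMDiffAt.comp q (hΦs.contMDiffAt (hO.mem_nhds hq))).clm_apply
      contMDiffAt_const).contMDiffWithinAt
  · rw [hframe q e he.symm]
    exact (span_range_inverse_prod_eq_ker he.symm (hk q hq) b).1
  · rw [hframe q e he.symm]
    exact (span_range_inverse_prod_eq_ker he.symm (hk q hq) b).2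

theorem exists_isSmoothFrameOn_ker [FiniteDimensional ℝ E] [FiniteDimensional ℝ F]
    {A : M → E →L[ℝ] F} {O : Set M}
    (hO : IsOpen O) (hA : ContMDiffOn I 𝓘(ℝ, E →L[ℝ] F) ∞ A O)
    (hk : ∀ q ∈ O, finrank ℝ (LinearMap.ker (A q : E →ₗ[ℝ] F)) = k) {p : M} (hp : p ∈ O) :
    ∃ U ⊆ O, p ∈ U ∧ ∃ a : M → Fin k → E,
      IsSmoothFrameOn I (fun q => LinearMap.ker (A q : E →ₗ[ℝ] F)) U a := by
  obtain ⟨ρ, κ, e₀, he₀⟩ := exists_continuousLinearEquiv_range_prod_ker (A p)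
  exact exists_isSmoothFrameOn_ker_of_prod_eq hO hA hk hp he₀ (finBasisOfFinrankEq ℝ _ (hk p hp))

namespace IsSmoothFrameOn

variable {α : M → Submodule ℝ E} {O : Set M} {a : M → Fin k → E} {p : M}

theorem injective_frameMap (ha : IsSmoothFrameOn I α O a) (hp : p ∈ O) :
    Function.Injective (frameMap a p) := by
  rw [← ContinuousLinearMap.coe_coe, coe_frameMap,
    ← linearIndependent_iff_injective_fintypeLinearCombination]
  exact ha.linearIndependent p hp

theorem range_frameMap (ha : IsSmoothFrameOn I α O a) (hp : p ∈ O) :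
    LinearMap.range (frameMap a p : (Fin k → ℝ) →ₗ[ℝ] E) = α p := by
  rw [coe_frameMap, Fintype.range_linearCombination, ha.span p hp]

theorem sweep_mem (ha : IsSmoothFrameOn I α O a) (hp : p ∈ O) (t : Fin k → ℝ) :
    sweep a (p, t) ∈ α p := by
  rw [← ha.range_frameMap hp, ← frameMap_apply]
  exact LinearMap.mem_range_self _ t

theorem contMDiffOn_frameMap (ha : IsSmoothFrameOn I α O a) :
    ContMDiffOn I 𝓘(ℝ, (Fin k → ℝ) →L[ℝ] E) ∞ (frameMap a) O :=
  contMDiffOn_finsetSum fun i _ =>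
    (ContinuousLinearMap.smulRightL ℝ (Fin k → ℝ) E
      (ContinuousLinearMap.proj i)).contDiff.contMDiff.comp_contMDiffOn (ha.smooth i)

theorem mdifferentiableAt_frameMap (ha : IsSmoothFrameOn I α O a) (hp : p ∈ O) :
    MDifferentiableAt I 𝓘(ℝ, (Fin k → ℝ) →L[ℝ] E) (frameMap a) p :=
  (ha.contMDiffOn_frameMap.contMDiffAt (ha.isOpen.mem_nhds hp)).mdifferentiableAt (by simp)

theorem contMDiffOn_sweep (ha : IsSmoothFrameOn I α O a) :
    ContMDiffOn (I.prod 𝓘(ℝ, Fin k → ℝ)) 𝓘(ℝ, E) ∞ (sweep a) (O ×ˢ Set.univ) := by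
  rw [sweep_eq_frameMap]
  exact (ha.contMDiffOn_frameMap.comp contMDiff_fst.contMDiffOn fun q hq => hq.1).clm_apply
    contMDiff_snd.contMDiffOn

theorem mdifferentiableAt_sweep (ha : IsSmoothFrameOn I α O a) (hp : p ∈ O) (t : Fin k → ℝ) :
    MDifferentiableAt (I.prod 𝓘(ℝ, Fin k → ℝ)) 𝓘(ℝ, E) (sweep a) (p, t) :=
  (ha.contMDiffOn_sweep.contMDiffAt
    ((ha.isOpen.prod isOpen_univ).mem_nhds ⟨hp, trivial⟩)).mdifferentiableAt (by simp)

theorem mvfderiv_sweep (ha : IsSmoothFrameOn I α O a) (hp : p ∈ O) (t : Fin k → ℝ)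
    (v : TangentSpace I p × (Fin k → ℝ)) :
    mvfderiv (I.prod 𝓘(ℝ, Fin k → ℝ)) (sweep a) (p, t) v =
      frameMap a p v.2 + mvfderiv I (frameMap a) p v.1 t := by
  have hf := ha.mdifferentiableAt_frameMap hp
  have hA : MDifferentiableAt (I.prod 𝓘(ℝ, Fin k → ℝ)) 𝓘(ℝ, (Fin k → ℝ) →L[ℝ] E)
      (frameMap a ∘ Prod.fst) (p, t) := hf.comp (p, t) mdifferentiableAt_fst
  rw [sweep_eq_frameMap]
  refine (mvfderiv_clm_apply hA mdifferentiableAt_snd v).trans (congrArg₂ _ (congrArg _ ?_) ?_)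
  · exact congr($(mfderiv_snd (I := I) (I' := 𝓘(ℝ, Fin k → ℝ)) (x := (p, t))) v)
  · have hcomp := mvfderiv_vector_comp_apply (J := I.prod 𝓘(ℝ, Fin k → ℝ)) (q := (p, t)) hf
      mdifferentiableAt_fst v
    have hfst := congr($(mfderiv_fst (I := I) (I' := 𝓘(ℝ, Fin k → ℝ)) (x := (p, t))) v)
    exact congr($(hcomp.trans (congrArg (mvfderiv I (frameMap a) p) hfst)) t)

theorem homogeneousTangent_sweep (ha : IsSmoothFrameOn I α O a) (hp : p ∈ O) (t : Fin k → ℝ) :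
    homogeneousTangent (I.prod 𝓘(ℝ, Fin k → ℝ)) (sweep a) (p, t) =
      LinearMap.range ((frameMap a p : (Fin k → ℝ) →ₗ[ℝ] E).coprod
        (ContinuousLinearMap.apply ℝ E t ∘L mvfderiv I (frameMap a) p :
          TangentSpace I p →ₗ[ℝ] E)) := by
  refine le_antisymm (homogeneousTangent_le_iff.2 ⟨⟨(t, 0), ?_⟩, fun v => ⟨(v.2, v.1), ?_⟩⟩) ?_
  · simp [frameMap_apply]
  · exact (ha.mvfderiv_sweep hp t v).symm
  · rintro _ ⟨⟨s, v⟩, rfl⟩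
    exact Set.mem_of_eq_of_mem (ha.mvfderiv_sweep hp t (v, s)).symm
      (mvfderiv_mem_homogeneousTangent _ _ _)

theorem le_homogeneousTangent_sweep (ha : IsSmoothFrameOn I α O a) (hp : p ∈ O) (t : Fin k → ℝ) :
    α p ≤ homogeneousTangent (I.prod 𝓘(ℝ, Fin k → ℝ)) (sweep a) (p, t) := by
  rw [ha.homogeneousTangent_sweep hp, LinearMap.range_coprod, ha.range_frameMap hp]
  exact le_sup_left

theorem exists_affineMap_range_eq_homogeneousTangent_sweep (ha : IsSmoothFrameOn I α O a)
    (hp : p ∈ O) :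
    ∃ Φ : (Fin k → ℝ) →ᵃ[ℝ] ((Fin k → ℝ) × TangentSpace I p →ₗ[ℝ] E), ∀ t,
      LinearMap.range (Φ t) = homogeneousTangent (I.prod 𝓘(ℝ, Fin k → ℝ)) (sweep a) (p, t) := by
  let D : TangentSpace I p →ₗ[ℝ] (Fin k → ℝ) →ₗ[ℝ] E :=
    ContinuousLinearMap.coeLM ℝ ∘ₗ (mvfderiv I (frameMap a) p : TangentSpace I p →ₗ[ℝ] _)
  refine ⟨AffineMap.const ℝ _ ((frameMap a p : (Fin k → ℝ) →ₗ[ℝ] E) ∘ₗ LinearMap.fst ℝ _ _) +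
    (D ∘ₗ LinearMap.snd ℝ (Fin k → ℝ) _).flip.toAffineMap, fun t => ?_⟩
  rw [ha.homogeneousTangent_sweep hp]
  rfl

theorem exists_coordinates [FiniteDimensional ℝ E] (ha : IsSmoothFrameOn I α O a) {g : N → M}
    {Y : N → E} {q : N} (hq : g q ∈ O) (hg : MDifferentiableAt J I g q)
    (hY : MDifferentiableAt J 𝓘(ℝ, E) Y q) (hYα : ∀ᶠ q' in 𝓝 q, Y q' ∈ α (g q')) :
    ∃ t : N → Fin k → ℝ, MDifferentiableAt J 𝓘(ℝ, Fin k → ℝ) t q ∧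
      Y =ᶠ[𝓝 q] fun q' => sweep a (g q', t q') := by
  obtain ⟨R, hR⟩ := LinearMap.exists_leftInverse_of_injective
    (frameMap a (g q) : (Fin k → ℝ) →ₗ[ℝ] E) (LinearMap.ker_eq_bot.2 (ha.injective_frameMap hq))
  set ρ := R.toContinuousLinearMap
  set Φ := fun q' => ρ ∘L frameMap a (g q')
  have hΦq : Φ q = ContinuousLinearEquiv.refl ℝ (Fin k → ℝ) := by
    ext1 t
    exact congr($hR t)
  have hΦd : MDifferentiableAt J 𝓘(ℝ, (Fin k → ℝ) →L[ℝ] Fin k → ℝ) Φ q :=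
    (ContinuousLinearMap.compL ℝ (Fin k → ℝ) E (Fin k → ℝ)
      ρ).differentiableAt.mdifferentiableAt.comp q ((ha.mdifferentiableAt_frameMap hq).comp q hg)
  have hinv : DifferentiableAt ℝ ContinuousLinearMap.inverse (Φ q) := by
    rw [hΦq]
    exact (contDiffAt_map_inverse (n := 1) _).differentiableAt (by simp)
  refine ⟨fun q' => (Φ q').inverse (ρ (Y q')), ?_, ?_⟩
  · exact (hinv.mdifferentiableAt.comp q hΦd).clm_apply
      (ρ.differentiableAt.mdifferentiableAt.comp q hY)
  · have hunit : ∀ᶠ q' in 𝓝 q,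
        Φ q' ∈ Set.range ((↑) : ((Fin k → ℝ) ≃L[ℝ] (Fin k → ℝ)) → _) :=
      hΦd.continuousAt.eventually (ContinuousLinearEquiv.isOpen.mem_nhds ⟨_, hΦq.symm⟩)
    filter_upwards [hunit, hYα, hg.continuousAt.eventually (ha.isOpen.mem_nhds hq)]
      with q' ⟨e, he⟩ hYq' hq'
    rw [← ha.range_frameMap hq'] at hYq'
    obtain ⟨t, ht⟩ := hYq'
    have hΦt : ρ (Y q') = e t := by
      rw [← ht, ← ContinuousLinearEquiv.coe_coe, he]
      rfl
    rw [← frameMap_apply, ← he, ContinuousLinearMap.inverse_equiv, hΦt]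
    simp [← ht]

theorem exists_homogeneousTangent_le [FiniteDimensional ℝ E] (ha : IsSmoothFrameOn I α O a)
    {g : N → M} {Y : N → E} {q : N} (hq : g q ∈ O) (hg : MDifferentiableAt J I g q)
    (hY : MDifferentiableAt J 𝓘(ℝ, E) Y q) (hYα : ∀ᶠ q' in 𝓝 q, Y q' ∈ α (g q')) :
    ∃ t, sweep a (g q, t) = Y q ∧
      homogeneousTangent J Y q ≤
        homogeneousTangent (I.prod 𝓘(ℝ, Fin k → ℝ)) (sweep a) (g q, t) := by
  obtain ⟨t, ht, hYt⟩ := ha.exists_coordinates hq hg hY hYα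
  have hgt : MDifferentiableAt J (I.prod 𝓘(ℝ, Fin k → ℝ)) (fun q' => (g q', t q')) q :=
    hg.prodMk ht
  exact ⟨t q, hYt.eq_of_nhds.symm, (homogeneousTangent_congr hYt).trans_le
    (homogeneousTangent_comp_le (f := sweep a) (g := fun q' => (g q', t q'))
      (ha.mdifferentiableAt_sweep hq (t q)) hgt)⟩

end IsSmoothFrameOn

end Frames

/-! ### Characteristics of families of hyperplanes -/

section HyperplaneFamilies

variable {E : Type*} [NormedAddCommGroup E] [NormedSpace ℝ E]
  {B : Type*} [NormedAddCommGroup B] [NormedSpace ℝ B]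
  {H : Type*} [TopologicalSpace H] {I : ModelWithCorners ℝ B H}
  {M : Type*} [TopologicalSpace M] [ChartedSpace H M]
  {B' : Type*} [NormedAddCommGroup B'] [NormedSpace ℝ B']
  {H' : Type*} [TopologicalSpace H'] {J : ModelWithCorners ℝ B' H'}
  {N : Type*} [TopologicalSpace N] [ChartedSpace H' N]
  {ξ : M → Submodule ℝ E} {O U : Set M} {G : M → (E →L[ℝ] ℝ)} {p : M} {k r : ℕ}
  {a : M → Fin k → E}

variable (I) in
/-- Near `p`, the hyperplanes `ξ` form a smooth family, and this family has rank `r` at `p` as a map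
into the dual projective space. The Gauss map is the case of the tangent hyperplanes. -/
def HasDualRankAt (ξ : M → Submodule ℝ E) (p : M) (r : ℕ) : Prop :=
  ∃ (O : Set M) (G : M → (E →L[ℝ] ℝ)), p ∈ O ∧ IsSmoothEquationOn I ξ O G ∧
    finrank ℝ (homogeneousTangent I G p) = r + 1

theorem IsSmoothEquationOn.mdifferentiableAt (h : IsSmoothEquationOn I ξ O G) (hp : p ∈ O) :
    MDifferentiableAt I 𝓘(ℝ, E →L[ℝ] ℝ) G p :=
  (h.smooth.contMDiffAt (h.isOpen.mem_nhds hp)).mdifferentiableAt (by simp)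

theorem IsSmoothEquationOn.eq_ker (h : IsSmoothEquationOn I ξ O G) (hp : p ∈ O) :
    ξ p = LinearMap.ker (G p : E →ₗ[ℝ] ℝ) :=
  Submodule.ext (h.mem_iff p hp)

theorem IsSmoothEquationOn.finrank_add_one [FiniteDimensional ℝ E]
    (h : IsSmoothEquationOn I ξ O G) (hp : p ∈ O) : finrank ℝ (ξ p) + 1 = finrank ℝ E := by
  rw [h.eq_ker hp]
  exact Module.Dual.finrank_ker_add_one_of_ne_zero
    fun h0 => h.ne_zero p hp (ContinuousLinearMap.coe_injective h0)

theorem IsSmoothEquationOn.exists_eq_smul {G' : M → (E →L[ℝ] ℝ)} (h : IsSmoothEquationOn I ξ O G)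
    (h' : IsSmoothEquationOn I ξ U G') (hp : p ∈ O) (hp' : p ∈ U) : ∃ c : ℝ, G' p = c • G p := by
  have hmem : (G' p : E →ₗ[ℝ] ℝ) ∈ Submodule.span ℝ (Set.range fun _ : Unit => (G p : E →ₗ[ℝ] ℝ)) :=
    mem_span_of_iInf_ker_le_ker (by rw [iInf_const, ← h.eq_ker hp, ← h'.eq_ker hp'])
  rw [Set.range_const] at hmem
  obtain ⟨c, hc⟩ := Submodule.mem_span_singleton.1 hmem
  exact ⟨c, ContinuousLinearMap.coe_injective hc.symm⟩

theorem mem_characteristic_iff (h : IsSmoothEquationOn I ξ O G) (hp : p ∈ O) {y : E} :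
    y ∈ characteristic I ξ p ↔ ∀ g ∈ homogeneousTangent I G p, g y = 0 := by
  simp only [characteristic, Submodule.mem_iInf, LinearMap.mem_ker, ContinuousLinearMap.coe_coe]
  refine ⟨fun H => H O G h hp, fun H O' G' h' hp' g hg => H g ?_⟩
  refine homogeneousTangent_le_of_proportional (h.mdifferentiableAt hp) (h'.mdifferentiableAt hp')
    (h.ne_zero p hp) ?_ hg
  filter_upwards [h.isOpen.mem_nhds hp, h'.isOpen.mem_nhds hp'] with q hq hq'
    using h.exists_eq_smul h' hq hq'

theorem characteristic_le (h : IsSmoothEquationOn I ξ O G) (hp : p ∈ O) :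
    characteristic I ξ p ≤ ξ p := fun y hy =>
  (h.mem_iff p hp y).2 ((mem_characteristic_iff h hp).1 hy _ (mem_homogeneousTangent_self G p))

theorem IsSmoothEquationOn.mvfderiv_add_mvfderiv_eq_zero (h : IsSmoothEquationOn I ξ O G)
    {g : N → M} {Y : N → E} {q : N} (hq : g q ∈ O) (hg : MDifferentiableAt J I g q)
    (hY : MDifferentiableAt J 𝓘(ℝ, E) Y q) (hYξ : ∀ᶠ q' in 𝓝 q, Y q' ∈ ξ (g q'))
    (v : TangentSpace J q) :
    G (g q) (mvfderiv J Y q v) + mvfderiv I G (g q) (mfderiv J I g q v) (Y q) = 0 := by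
  have hG := h.mdifferentiableAt hq
  have hzero : (fun q' => (G ∘ g) q' (Y q')) =ᶠ[𝓝 q] fun _ => 0 := by
    filter_upwards [hYξ, hg.continuousAt.eventually (h.isOpen.mem_nhds hq)] with q' hYq' hq'
      using (h.mem_iff _ hq' _).1 hYq'
  have hd := congr($(mvfderiv_congr (I := J) hzero) v)
  rw [mvfderiv_clm_apply (hG.comp q hg) hY, mvfderiv_vector_comp_apply hG hg, mvfderiv_const] at hd
  exact hd

theorem homogeneousTangent_le_of_mem_characteristic (h : IsSmoothEquationOn I ξ O G)
    {g : N → M} {Y : N → E} {q : N} (hq : g q ∈ O) (hg : MDifferentiableAt J I g q)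
    (hY : MDifferentiableAt J 𝓘(ℝ, E) Y q) (hYξ : ∀ᶠ q' in 𝓝 q, Y q' ∈ ξ (g q'))
    (hYq : Y q ∈ characteristic I ξ (g q)) : homogeneousTangent J Y q ≤ ξ (g q) := by
  refine homogeneousTangent_le_iff.2 ⟨hYξ.self_of_nhds, fun v => (h.mem_iff _ hq _).2 ?_⟩
  rw [← h.mvfderiv_add_mvfderiv_eq_zero hq hg hY hYξ v, left_eq_add]
  exact (mem_characteristic_iff h hq).1 hYq _ (mvfderiv_mem_homogeneousTangent _ _ _)

theorem mem_characteristic_of_homogeneousTangent_le (h : IsSmoothEquationOn I ξ O G)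
    {g : N → M} {Y : N → E} {q : N} (hq : g q ∈ O) (hg : MDifferentiableAt J I g q)
    (hs : Function.Surjective (mfderiv J I g q)) (hY : MDifferentiableAt J 𝓘(ℝ, E) Y q)
    (hYξ : ∀ᶠ q' in 𝓝 q, Y q' ∈ ξ (g q')) (hle : homogeneousTangent J Y q ≤ ξ (g q)) :
    Y q ∈ characteristic I ξ (g q) := by
  have hannihilates : homogeneousTangent I G (g q) ≤
      LinearMap.ker (ContinuousLinearMap.apply ℝ ℝ (Y q) : (E →L[ℝ] ℝ) →ₗ[ℝ] ℝ) := by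
    refine homogeneousTangent_le_iff.2 ⟨(h.mem_iff _ hq _).1 hYξ.self_of_nhds, fun v => ?_⟩
    obtain ⟨v, rfl⟩ := hs v
    have hv := h.mvfderiv_add_mvfderiv_eq_zero hq hg hY hYξ v
    rwa [(h.mem_iff _ hq _).1 (hle (mvfderiv_mem_homogeneousTangent Y q v)), zero_add] at hv
  exact (mem_characteristic_iff h hq).2 hannihilates

theorem exists_isSmoothFrameOn_characteristic [FiniteDimensional ℝ E] [FiniteDimensional ℝ B]
    [I.Boundaryless] [IsManifold I ∞ M] (h : IsSmoothEquationOn I ξ O G)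
    (hk : ∀ q ∈ O, finrank ℝ (characteristic I ξ q) = k) (hp : p ∈ O) :
    ∃ U, p ∈ U ∧ ∃ a : M → Fin k → E, IsSmoothFrameOn I (characteristic I ξ) U a := by
  obtain ⟨U, hUO, hU, hpU, L, hL, hrange⟩ :=
    exists_contMDiffOn_range_eq_homogeneousTangent h.isOpen h.smooth hp
  have hker : ∀ q ∈ U, LinearMap.ker ((L q).flip : E →ₗ[ℝ] (ℝ × B →L[ℝ] ℝ)) =
      characteristic I ξ q := fun q hq => by
    ext y
    rw [mem_characteristic_iff h (hUO hq), ← hrange q hq]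
    exact ⟨fun hy g ⟨u, hu⟩ => hu ▸ congr($hy u),
      fun hy => ContinuousLinearMap.ext fun u => hy _ ⟨u, rfl⟩⟩
  have hflip : ContMDiffOn I 𝓘(ℝ, E →L[ℝ] (ℝ × B →L[ℝ] ℝ)) ∞
      (ContinuousLinearMap.flipₗᵢ ℝ (ℝ × B) E ℝ ∘ L) U :=
    (LinearIsometryEquiv.contDiff _).contMDiff.comp_contMDiffOn hL
  obtain ⟨U', hU', hpU', a, ha⟩ := exists_isSmoothFrameOn_ker hU hflip
    (fun q hq => (congrArg (fun T : Submodule ℝ E => finrank ℝ T) (hker q hq)).trans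
      (hk q (hUO hq))) hpU
  exact ⟨U', hpU', a, ha.isOpen, ha.smooth, ha.linearIndependent,
    fun q hq => (ha.span q hq).trans (hker q (hU' hq))⟩

namespace IsSmoothFrameOn

theorem homogeneousTangent_sweep_le (ha : IsSmoothFrameOn I (characteristic I ξ) U a)
    (h : IsSmoothEquationOn I ξ O G) (hpU : p ∈ U) (hp : p ∈ O) (t : Fin k → ℝ) :
    homogeneousTangent (I.prod 𝓘(ℝ, Fin k → ℝ)) (sweep a) (p, t) ≤ ξ p := by
  have hξ : ∀ᶠ q in 𝓝 (p, t), sweep a q ∈ ξ q.1 := by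
    filter_upwards [((ha.isOpen.inter h.isOpen).prod isOpen_univ).mem_nhds ⟨⟨hpU, hp⟩, trivial⟩]
      with q hq using characteristic_le h hq.1.2 (ha.sweep_mem hq.1.1 q.2)
  exact homogeneousTangent_le_of_mem_characteristic (g := Prod.fst) (q := (p, t)) h hp
    mdifferentiableAt_fst (ha.mdifferentiableAt_sweep hpU t) hξ (ha.sweep_mem hpU t)

theorem sweep_ne_zero_iff {α : M → Submodule ℝ E} (ha : IsSmoothFrameOn I α U a) (hpU : p ∈ U)
    {t : Fin k → ℝ} : sweep a (p, t) ≠ 0 ↔ t ≠ 0 := by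
  rw [← frameMap_apply, map_ne_zero_iff _ (ha.injective_frameMap hpU)]

variable [FiniteDimensional ℝ E]

theorem homogeneousTangent_sweep_eq (ha : IsSmoothFrameOn I (characteristic I ξ) U a)
    (h : IsSmoothEquationOn I ξ O G) (hpU : p ∈ U) (hp : p ∈ O) {t : Fin k → ℝ}
    (ht : IsRegularHypersurfacePoint (I.prod 𝓘(ℝ, Fin k → ℝ)) (sweep a) (p, t)) :
    homogeneousTangent (I.prod 𝓘(ℝ, Fin k → ℝ)) (sweep a) (p, t) = ξ p :=
  Submodule.eq_of_le_of_finrank_eq (ha.homogeneousTangent_sweep_le h hpU hp t)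
    (Nat.add_right_cancel (ht.2.trans (h.finrank_add_one hp).symm))

theorem isRegularHypersurfacePoint_sweep_iff (ha : IsSmoothFrameOn I (characteristic I ξ) U a)
    (h : IsSmoothEquationOn I ξ O G) (hpU : p ∈ U) (hp : p ∈ O) {t : Fin k → ℝ} :
    IsRegularHypersurfacePoint (I.prod 𝓘(ℝ, Fin k → ℝ)) (sweep a) (p, t) ↔
      t ≠ 0 ∧ finrank ℝ (ξ p) ≤
        finrank ℝ (homogeneousTangent (I.prod 𝓘(ℝ, Fin k → ℝ)) (sweep a) (p, t)) := by
  have hle := Submodule.finrank_mono (ha.homogeneousTangent_sweep_le h hpU hp t)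
  rw [IsRegularHypersurfacePoint, ← h.finrank_add_one hp, Nat.add_right_cancel_iff,
    ha.sweep_ne_zero_iff hpU, le_antisymm_iff, and_iff_right hle]

theorem dense_isRegularHypersurfacePoint_sweep
    (ha : IsSmoothFrameOn I (characteristic I ξ) U a) (h : IsSmoothEquationOn I ξ O G)
    (hpU : p ∈ U) (hp : p ∈ O) {t₀ : Fin k → ℝ}
    (ht₀ : IsRegularHypersurfacePoint (I.prod 𝓘(ℝ, Fin k → ℝ)) (sweep a) (p, t₀)) :
    Dense {t | IsRegularHypersurfacePoint (I.prod 𝓘(ℝ, Fin k → ℝ)) (sweep a) (p, t)} := by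
  obtain ⟨Φ, hΦ⟩ := ha.exists_affineMap_range_eq_homogeneousTangent_sweep hpU
  rw [ha.isRegularHypersurfacePoint_sweep_iff h hpU hp, ← hΦ] at ht₀
  have : Nontrivial (Fin k → ℝ) := ⟨t₀, 0, ht₀.1⟩
  refine ((dense_compl_singleton 0).inter_of_isOpen_left (dense_setOf_le_finrank_range Φ ht₀.2)
    isOpen_compl_singleton).mono fun t ht => ?_
  exact (ha.isRegularHypersurfacePoint_sweep_iff h hpU hp).2 ⟨ht.1, ht.2.trans_eq (by rw [hΦ])⟩

theorem exists_isRegularHypersurfacePoint_sweep (ha : IsSmoothFrameOn I (characteristic I ξ) U a)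
    (h : IsSmoothEquationOn I ξ O G) {g : N → M} {Y : N → E} {q : N} (hqU : g q ∈ U) (hq : g q ∈ O)
    (hg : MDifferentiableAt J I g q) (hY : MDifferentiableAt J 𝓘(ℝ, E) Y q)
    (hYα : ∀ᶠ q' in 𝓝 q, Y q' ∈ characteristic I ξ (g q')) (hY₀ : Y q ≠ 0)
    (hcodim : finrank ℝ E ≤ finrank ℝ (homogeneousTangent J Y q) + 2)
    (hα : ¬ characteristic I ξ (g q) ≤ homogeneousTangent J Y q) :
    ∃ t, IsRegularHypersurfacePoint (I.prod 𝓘(ℝ, Fin k → ℝ)) (sweep a) (g q, t) := by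
  obtain ⟨t, htY, hle⟩ := ha.exists_homogeneousTangent_le hqU hg hY hYα
  have hlt := Submodule.finrank_lt_finrank_of_lt
    (lt_of_le_not_ge hle fun hge => hα ((ha.le_homogeneousTangent_sweep hqU t).trans hge))
  refine ⟨t, (ha.isRegularHypersurfacePoint_sweep_iff h hqU hq).2
    ⟨(ha.sweep_ne_zero_iff hqU).1 (htY ▸ hY₀), ?_⟩⟩
  rw [← h.finrank_add_one hq] at hcodim
  omega

variable [I.Boundaryless] [IsManifold I ∞ M]

theorem eventually_isRegularHypersurfacePoint_sweep
    (ha : IsSmoothFrameOn I (characteristic I ξ) U a) (h : IsSmoothEquationOn I ξ O G)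
    (hpU : p ∈ U) (hp : p ∈ O) {t : Fin k → ℝ}
    (ht : IsRegularHypersurfacePoint (I.prod 𝓘(ℝ, Fin k → ℝ)) (sweep a) (p, t)) :
    ∀ᶠ q in 𝓝 (p, t), IsRegularHypersurfacePoint (I.prod 𝓘(ℝ, Fin k → ℝ)) (sweep a) q := by
  have ht' := (ha.isRegularHypersurfacePoint_sweep_iff h hpU hp).1 ht
  filter_upwards [eventually_le_finrank_homogeneousTangent (ha.isOpen.prod isOpen_univ)
      ha.contMDiffOn_sweep ⟨hpU, trivial⟩ ht'.2, continuousAt_snd.eventually_ne ht'.1,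
    ((ha.isOpen.inter h.isOpen).prod isOpen_univ).mem_nhds ⟨⟨hpU, hp⟩, trivial⟩] with q hqt hq0 hq
  refine (ha.isRegularHypersurfacePoint_sweep_iff h hq.1.1 hq.1.2).2 ⟨hq0, ?_⟩
  rwa [Nat.add_right_cancel ((h.finrank_add_one hq.1.2).trans (h.finrank_add_one hp).symm)]

theorem hasGaussRankAt_sweep (ha : IsSmoothFrameOn I (characteristic I ξ) U a) (hpU : p ∈ U)
    (hr : HasDualRankAt I ξ p r) {t : Fin k → ℝ}
    (ht : IsRegularHypersurfacePoint (I.prod 𝓘(ℝ, Fin k → ℝ)) (sweep a) (p, t)) :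
    HasGaussRankAt (I.prod 𝓘(ℝ, Fin k → ℝ)) (sweep a) (p, t) r := by
  obtain ⟨O, G, hp, h, hrank⟩ := hr
  obtain ⟨S, hS, hSo, hpS⟩ := mem_nhds_iff.1 (inter_mem
    (((ha.isOpen.inter h.isOpen).prod isOpen_univ).mem_nhds ⟨⟨hpU, hp⟩, trivial⟩)
    (ha.eventually_isRegularHypersurfacePoint_sweep h hpU hp ht))
  have htangent : ∀ q ∈ S,
      homogeneousTangent (I.prod 𝓘(ℝ, Fin k → ℝ)) (sweep a) q = ξ q.1 := fun q hq =>
    ha.homogeneousTangent_sweep_eq h (hS hq).1.1.1 (hS hq).1.1.2 (hS hq).2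
  refine ⟨S, G ∘ Prod.fst, hpS, ⟨hSo, ?_, fun q hq => h.ne_zero _ (hS hq).1.1.2,
    fun q hq y => ?_⟩, ?_⟩
  · exact h.smooth.comp contMDiff_fst.contMDiffOn fun q hq => (hS hq).1.1.2
  · rw [htangent q hq, h.mem_iff _ (hS hq).1.1.2, Function.comp_apply]
  · have hsurj : Function.Surjective (mfderiv (I.prod 𝓘(ℝ, Fin k → ℝ)) I Prod.fst (p, t)) := by
      rw [mfderiv_fst]
      exact Prod.fst_surjective
    rw [homogeneousTangent_comp_of_surjective (h.mdifferentiableAt hp) mdifferentiableAt_fst hsurj,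
      hrank]

theorem isTangentiallyDegenerateOn_sweep (ha : IsSmoothFrameOn I (characteristic I ξ) U a)
    (hξ : ∀ p ∈ U, HasDualRankAt I ξ p r) (hreg : ∀ p ∈ U, ∃ t,
      IsRegularHypersurfacePoint (I.prod 𝓘(ℝ, Fin k → ℝ)) (sweep a) (p, t))
    (hr : r + 2 < finrank ℝ E) :
    IsTangentiallyDegenerateOn (I.prod 𝓘(ℝ, Fin k → ℝ)) (sweep a) (U ×ˢ Set.univ) r where
  isOpen := ha.isOpen.prod isOpen_univ
  smooth := ha.contMDiffOn_sweep
  regular_dense := by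
    rintro ⟨p, t⟩ ⟨hp, -⟩
    obtain ⟨O, G, hpO, h, -⟩ := hξ p hp
    obtain ⟨t₀, ht₀⟩ := hreg p hp
    exact map_mem_closure (f := fun t => (p, t)) (by fun_prop)
      (ha.dense_isRegularHypersurfacePoint_sweep h hp hpO ht₀ t) fun t ht => ⟨⟨hp, trivial⟩, ht⟩
  gauss_rank := fun q hq ht => ha.hasGaussRankAt_sweep hq.1 (hξ q.1 hq.1) ht
  rank_lt := hr

end IsSmoothFrameOn

end HyperplaneFamilies

/-! ### Maps that are constant on the fibres of a submersion -/

section Submersions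

theorem fderiv_apply_eq_zero_of_eqOn_fiber {E F D : Type*} [NormedAddCommGroup E] [NormedSpace ℝ E]
    [NormedAddCommGroup F] [NormedSpace ℝ F] [CompleteSpace F]
    [NormedAddCommGroup D] [NormedSpace ℝ D] [CompleteSpace D] {f : D → F} {X : D → E} {u : D}
    (hf : ContDiffAt ℝ 1 f u) (hX : ContDiffAt ℝ 1 X u)
    (hs : Function.Surjective (fderiv ℝ f u)) (hfX : ∀ᶠ u' in 𝓝 u, f u' = f u → X u' = X u)
    {v : D} (hv : fderiv ℝ f u v = 0) : fderiv ℝ X u v = 0 := by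
  refine SeparatingDual.eq_zero_of_forall_dual_eq_zero (R := ℝ) fun φ => ?_
  have hconst : IsLocalExtrOn (φ ∘ X) {u' | f u' = f u} u := by
    refine Or.inl ?_
    filter_upwards [mem_nhdsWithin_of_mem_nhds hfX, self_mem_nhdsWithin] with u' hu' hfu'
    exact (congrArg φ (hu' hfu')).ge
  obtain ⟨Λ, Λ₀, hΛ, hmul⟩ := hconst.exists_linear_map_of_hasStrictFDerivAt
    (hf.hasStrictFDerivAt one_ne_zero)
    (φ.hasStrictFDerivAt.comp u (hX.hasStrictFDerivAt one_ne_zero))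
  have hΛ₀ : Λ₀ ≠ 0 := by
    rintro rfl
    refine hΛ (Prod.ext (LinearMap.ext fun y => ?_) rfl)
    obtain ⟨v, rfl⟩ := hs y
    simpa using hmul v
  simpa [hv, hΛ₀] using hmul v

variable {E : Type*} [NormedAddCommGroup E] [NormedSpace ℝ E]
  {B : Type*} [NormedAddCommGroup B] [NormedSpace ℝ B] [CompleteSpace B]
  {H : Type*} [TopologicalSpace H] {I : ModelWithCorners ℝ B H}
  {M : Type*} [TopologicalSpace M] [ChartedSpace H M]
  {B' : Type*} [NormedAddCommGroup B'] [NormedSpace ℝ B'] [CompleteSpace B']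
  {H' : Type*} [TopologicalSpace H'] {J : ModelWithCorners ℝ B' H'} [J.Boundaryless]
  {N : Type*} [TopologicalSpace N] [ChartedSpace H' N]

theorem mvfderiv_apply_eq_zero_of_eqOn_fiber {f : N → M} {X : N → E} {q : N}
    (hf : ContMDiffAt J I 1 f q) (hX : ContMDiffAt J 𝓘(ℝ, E) 1 X q)
    (hs : Function.Surjective (mfderiv J I f q)) (hfX : ∀ᶠ q' in 𝓝 q, f q' = f q → X q' = X q)
    {v : TangentSpace J q} (hv : mfderiv J I f q v = 0) : mvfderiv J X q v = 0 := by
  have hdf : mfderiv J I f q = fderiv ℝ (writtenInExtChartAt J I q f) (extChartAt J q q) := by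
    rw [(hf.mdifferentiableAt one_ne_zero).mfderiv, J.range_eq_univ, fderivWithin_univ]
  have hdX : mvfderiv J X q = fderiv ℝ (X ∘ (extChartAt J q).symm) (extChartAt J q q) := by
    rw [(hX.mdifferentiableAt one_ne_zero).mvfderiv, J.range_eq_univ, fderivWithin_univ]
    rfl
  rw [contMDiffAt_iff, J.range_eq_univ, contDiffWithinAt_univ] at hf hX
  rw [hdf] at hs hv
  rw [hdX]
  refine fderiv_apply_eq_zero_of_eqOn_fiber hf.2 hX.2 hs ?_ hv
  have hsymm : Tendsto (extChartAt J q).symm (𝓝 (extChartAt J q q)) (𝓝 q) := by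
    simpa [ContinuousAt] using continuousAt_extChartAt_symm q
  have hsource := (hf.1.tendsto.comp hsymm).eventually (extChartAt_source_mem_nhds (I := I) (f q))
  filter_upwards [hsymm.eventually hfX, hsource] with u hu hfu heq
  simp only [Function.comp_apply, extChartAt_to_inv] at heq ⊢
  exact hu ((extChartAt I (f q)).injOn hfu (mem_extChartAt_source (f q)) heq)

end Submersions

/-! ### Polarity with respect to the Darboux hyperquadric -/

section DarbouxForm

variable {n : ℕ}

theorem darbouxForm_apply (X Y : Polyspherical n) :
    darbouxForm n X Y = inner ℝ X.1 Y.1 - X.2 * Y.2 := rfl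

theorem isSymm_darbouxForm : (darbouxForm n).IsSymm :=
  ⟨fun X Y => by rw [darbouxForm_apply, darbouxForm_apply, real_inner_comm, mul_comm]⟩

theorem nondegenerate_darbouxForm : (darbouxForm n).Nondegenerate := by
  have hsep : ∀ X, (∀ Y, darbouxForm n X Y = 0) → X = 0 := fun X hX => by
    have hreflect : ‖X.1‖ ^ 2 + X.2 ^ 2 = 0 := by
      simpa [darbouxForm_apply, sq X.2] using hX (X.1, -X.2)
    obtain ⟨h₁, h₂⟩ := (add_eq_zero_iff_of_nonneg (sq_nonneg _) (sq_nonneg _)).1 hreflect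
    exact Prod.ext (norm_eq_zero.1 (pow_eq_zero_iff two_ne_zero |>.1 h₁))
      (pow_eq_zero_iff two_ne_zero |>.1 h₂)
  exact ⟨hsep, fun X hX => hsep X fun Y => (isSymm_darbouxForm.eq X Y).trans (hX Y)⟩

theorem finrank_polyspherical : finrank ℝ (Polyspherical n) = n + 2 := by
  rw [finrank_prod, finrank_euclideanSpace_fin, finrank_self]

theorem finrank_polar (T : Submodule ℝ (Polyspherical n)) :
    finrank ℝ (polar T) = n + 2 - finrank ℝ T := by
  rw [polar, LinearMap.BilinForm.finrank_orthogonal nondegenerate_darbouxForm,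
    finrank_polyspherical]

theorem polar_le_polar_iff {S T : Submodule ℝ (Polyspherical n)} :
    polar S ≤ polar T ↔ T ≤ S := by
  refine ⟨fun h => ?_, LinearMap.BilinForm.orthogonal_le⟩
  have hpolar := LinearMap.BilinForm.orthogonal_orthogonal (B := darbouxForm n)
    nondegenerate_darbouxForm isSymm_darbouxForm.isRefl
  rw [← hpolar S, ← hpolar T]
  exact LinearMap.BilinForm.orthogonal_le h

theorem mem_polar_span_singleton {X Y : Polyspherical n} :
    Y ∈ polar (Submodule.span ℝ {X}) ↔ darbouxForm n X Y = 0 := by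
  rw [polar, LinearMap.BilinForm.orthogonal_span_singleton_eq_toLin_ker, LinearMap.mem_ker]
  rfl

variable (n) in
/-- The fundamental form as a continuous bilinear map. It sends a point of `Pⁿ⁺¹` to the tangential
coordinates of its polar hyperplane. -/
noncomputable def darbouxCLM : Polyspherical n →L[ℝ] Polyspherical n →L[ℝ] ℝ :=
  LinearMap.toContinuousLinearMap (LinearMap.toContinuousLinearMap.toLinearMap ∘ₗ darbouxForm n)

theorem darbouxCLM_apply (X Y : Polyspherical n) : darbouxCLM n X Y = darbouxForm n X Y := rfl

theorem injective_darbouxCLM : Function.Injective (darbouxCLM n) :=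
  (injective_iff_map_eq_zero _).2 fun X hX =>
    nondegenerate_darbouxForm.1 X fun Y => congr($hX Y)

end DarbouxForm

section Lifts

variable {E : Type*} [NormedAddCommGroup E] [NormedSpace ℝ E] {n r : ℕ}
  {B : Type*} [NormedAddCommGroup B] [NormedSpace ℝ B]
  {H : Type*} [TopologicalSpace H] {I : ModelWithCorners ℝ B H}
  {M : Type*} [TopologicalSpace M] [ChartedSpace H M] {O : Set M} {p : M}

namespace IsSmoothLiftOn

theorem mdifferentiableAt {z : M → ℙ ℝ E} {Z : M → E} (h : IsSmoothLiftOn I z O Z) (hp : p ∈ O) :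
    MDifferentiableAt I 𝓘(ℝ, E) Z p :=
  (h.smooth.contMDiffAt (h.isOpen.mem_nhds hp)).mdifferentiableAt (by simp)

theorem submodule_eq {z : M → ℙ ℝ E} {Z : M → E} (h : IsSmoothLiftOn I z O Z) (hp : p ∈ O) :
    (z p).submodule = Submodule.span ℝ {Z p} := by
  obtain ⟨h₀, hz⟩ := h.lift p hp
  rw [← hz, Projectivization.submodule_mk]

theorem projectiveTangent_eq {z : M → ℙ ℝ E} {Z : M → E} (h : IsSmoothLiftOn I z O Z)
    (hp : p ∈ O) : projectiveTangent I z p = homogeneousTangent I Z p := by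
  refine le_antisymm (iSup_le fun O' => iSup_le fun Z' => iSup_le fun h' => iSup_le fun hp' => ?_)
    (le_iSup_of_le O (le_iSup_of_le Z (le_iSup_of_le h (le_iSup_of_le hp le_rfl))))
  refine homogeneousTangent_le_of_proportional (h.mdifferentiableAt hp) (h'.mdifferentiableAt hp')
    (h.lift p hp).1 ?_
  filter_upwards [h.isOpen.mem_nhds hp, h'.isOpen.mem_nhds hp'] with q hq hq'
  have hmem : Z' q ∈ Submodule.span ℝ {Z q} := by
    rw [← h.submodule_eq hq, h'.submodule_eq hq']
    exact Submodule.mem_span_singleton_self _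
  obtain ⟨c, hc⟩ := Submodule.mem_span_singleton.1 hmem
  exact ⟨c, hc.symm⟩

variable {z : M → ℙ ℝ (Polyspherical n)} {Z : M → Polyspherical n}

theorem isSmoothEquationOn_polarFamily (h : IsSmoothLiftOn I z O Z) :
    IsSmoothEquationOn I (polarFamily z) O (fun p => darbouxCLM n (Z p)) where
  isOpen := h.isOpen
  smooth := (darbouxCLM n).contDiff.contMDiff.comp_contMDiffOn h.smooth
  ne_zero p hp := (map_ne_zero_iff _ injective_darbouxCLM).2 (h.lift p hp).1
  mem_iff p hp Y := by
    rw [polarFamily, h.submodule_eq hp, mem_polar_span_singleton, darbouxCLM_apply]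

theorem homogeneousTangent_darbouxCLM (h : IsSmoothLiftOn I z O Z) (hp : p ∈ O) :
    homogeneousTangent I (fun p => darbouxCLM n (Z p)) p =
      (projectiveTangent I z p).map (darbouxCLM n : Polyspherical n →ₗ[ℝ] _) := by
  rw [homogeneousTangent_clm_comp _ (h.mdifferentiableAt hp), h.projectiveTangent_eq hp]

theorem hasDualRankAt_polarFamily (h : IsSmoothLiftOn I z O Z) (hp : p ∈ O)
    (hr : finrank ℝ (projectiveTangent I z p) = r + 1) :
    HasDualRankAt I (polarFamily z) p r := by
  refine ⟨O, _, hp, h.isSmoothEquationOn_polarFamily, ?_⟩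
  rw [h.homogeneousTangent_darbouxCLM hp, ← hr]
  exact (Submodule.equivMapOfInjective _ injective_darbouxCLM _).finrank_eq.symm

end IsSmoothLiftOn

theorem characteristic_polarFamily {z : M → ℙ ℝ (Polyspherical n)} (hz : IsSmoothProjective I z)
    (p : M) : characteristic I (polarFamily z) p = polar (projectiveTangent I z p) := by
  obtain ⟨O, Z, hp, h⟩ := hz p
  ext Y
  rw [mem_characteristic_iff h.isSmoothEquationOn_polarFamily hp,
    h.homogeneousTangent_darbouxCLM hp, polar, LinearMap.BilinForm.mem_orthogonal_iff]
  exact Set.forall_mem_image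

end Lifts

/-! ### Canal hypersurfaces -/

section ConformalSpace

variable {n : ℕ}
  {B : Type*} [NormedAddCommGroup B] [NormedSpace ℝ B]
  {H : Type*} [TopologicalSpace H] {I : ModelWithCorners ℝ B H}
  {M : Type*} [TopologicalSpace M] [ChartedSpace H M] {x : M → ConformalSpace n} {p : M}

theorem darbouxForm_darbouxPoint_eq_zero_iff {s t : ConformalSpace n} :
    darbouxForm n (darbouxPoint s) (darbouxPoint t) = 0 ↔ s = t := by
  rw [darbouxForm_apply, darbouxPoint, darbouxPoint, mul_one, sub_eq_zero,
    inner_eq_one_iff_of_norm_eq_one (norm_eq_of_mem_sphere s) (norm_eq_of_mem_sphere t),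
    Subtype.ext_iff]

theorem contMDiff_darbouxPoint :
    ContMDiff (𝓡 n) 𝓘(ℝ, Polyspherical n) ∞ (darbouxPoint (n := n)) :=
  have : Fact (finrank ℝ (EuclideanSpace ℝ (Fin (n + 1))) = n + 1) := ⟨finrank_euclideanSpace_fin⟩
  contMDiff_coe_sphere.prodMk_space contMDiff_const

theorem mdifferentiableAt_darbouxPoint (s : ConformalSpace n) :
    MDifferentiableAt (𝓡 n) 𝓘(ℝ, Polyspherical n) darbouxPoint s :=
  (contMDiff_darbouxPoint s).mdifferentiableAt (by simp)

theorem mdifferentiableAt_darbouxPoint_comp (hx : MDifferentiableAt I (𝓡 n) x p) :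
    MDifferentiableAt I 𝓘(ℝ, Polyspherical n) (fun q => darbouxPoint (x q)) p :=
  (mdifferentiableAt_darbouxPoint (x p)).comp p hx

theorem injective_mvfderiv_darbouxPoint (s : ConformalSpace n) :
    Function.Injective (mvfderiv (𝓡 n) darbouxPoint s) := by
  have : Fact (finrank ℝ (EuclideanSpace ℝ (Fin (n + 1))) = n + 1) := ⟨finrank_euclideanSpace_fin⟩
  refine Function.Injective.of_comp
    (f := ContinuousLinearMap.fst ℝ (EuclideanSpace ℝ (Fin (n + 1))) ℝ) ?_
  have hcoe : ContinuousLinearMap.fst ℝ (EuclideanSpace ℝ (Fin (n + 1))) ℝ ∘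
      mvfderiv (𝓡 n) darbouxPoint s =
        mvfderiv (𝓡 n) ((↑) : ConformalSpace n → EuclideanSpace ℝ (Fin (n + 1))) s :=
    funext fun v => (mvfderiv_clm_comp _ (mdifferentiableAt_darbouxPoint s) v).symm
  rw [hcoe]
  exact injective_mvfderiv_subtypeVal_sphere s

theorem injective_mvfderiv_darbouxPoint_comp (hx : MDifferentiableAt I (𝓡 n) x p)
    (hinj : Function.Injective (mfderiv I (𝓡 n) x p)) :
    Function.Injective (mvfderiv I (fun q => darbouxPoint (x q)) p) := fun v v' hv =>
  hinj <| injective_mvfderiv_darbouxPoint (x p) <|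
    (mvfderiv_vector_comp_apply (mdifferentiableAt_darbouxPoint (x p)) hx v).symm.trans <|
      hv.trans (mvfderiv_vector_comp_apply (mdifferentiableAt_darbouxPoint (x p)) hx v')

theorem mvfderiv_darbouxPoint_comp_snd (hx : MDifferentiableAt I (𝓡 n) x p)
    (v : TangentSpace I p) : (mvfderiv I (fun q => darbouxPoint (x q)) p v).2 = 0 := by
  have hsnd := mvfderiv_clm_comp (ContinuousLinearMap.snd ℝ (EuclideanSpace ℝ (Fin (n + 1))) ℝ)
    (mdifferentiableAt_darbouxPoint_comp hx) v
  refine hsnd.symm.trans ?_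
  simp only [darbouxPoint, ContinuousLinearMap.coe_snd', mvfderiv_const]
  rfl

theorem finrank_homogeneousTangent_darbouxPoint_comp (hx : MDifferentiableAt I (𝓡 n) x p)
    (hinj : Function.Injective (mfderiv I (𝓡 n) x p)) :
    finrank ℝ (homogeneousTangent I (fun q => darbouxPoint (x q)) p) = finrank ℝ B + 1 := by
  refine finrank_homogeneousTangent (injective_mvfderiv_darbouxPoint_comp hx hinj) ?_
  rintro ⟨v, hv⟩
  exact one_ne_zero ((congrArg Prod.snd hv).symm.trans (mvfderiv_darbouxPoint_comp_snd hx v))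

theorem homogeneousTangent_darbouxPoint_comp_le (hx : MDifferentiableAt I (𝓡 n) x p) :
    homogeneousTangent I (fun q => darbouxPoint (x q)) p ≤
      polar (Submodule.span ℝ {darbouxPoint (x p)}) := by
  have hX := mdifferentiableAt_darbouxPoint_comp hx
  refine homogeneousTangent_le_iff.2 ⟨mem_polar_span_singleton.2
    (darbouxForm_darbouxPoint_eq_zero_iff.2 rfl), fun v => mem_polar_span_singleton.2 ?_⟩
  have hnull : (fun q => darbouxCLM n (darbouxPoint (x q)) (darbouxPoint (x q))) = fun _ => 0 :=
    funext fun q => darbouxForm_darbouxPoint_eq_zero_iff.2 rfl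
  have hd := mvfderiv_clm_apply (A := fun q => darbouxCLM n (darbouxPoint (x q)))
    ((darbouxCLM n).differentiableAt.mdifferentiableAt.comp p hX) hX v
  rw [hnull, mvfderiv_const, mvfderiv_clm_comp _ hX, darbouxCLM_apply, darbouxCLM_apply] at hd
  have hsymm := isSymm_darbouxForm.eq (darbouxPoint (x p))
    (mvfderiv I (fun q => darbouxPoint (x q)) p v)
  exact self_eq_neg.1 (eq_neg_of_add_eq_zero_left ((congrArg _ hsymm).trans hd.symm))

end ConformalSpace

namespace IsCanalHypersurface

variable {n m r : ℕ}
  {V : Type*} [TopologicalSpace V] [ChartedSpace (EuclideanSpace ℝ (Fin (n - 1))) V]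
  {W : Type*} [TopologicalSpace W] [ChartedSpace (EuclideanSpace ℝ (Fin r)) W]
  {x : V → ConformalSpace n} {z : W → ℙ ℝ (Polyspherical n)} {π : V → W}

theorem mdifferentiableAt_param (h : IsCanalHypersurface n m r x z π) (p : V) :
    MDifferentiableAt (𝓡 (n - 1)) (𝓡 r) π p :=
  (h.smooth_param p).mdifferentiableAt (by simp)

theorem mdifferentiableAt (h : IsCanalHypersurface n m r x z π) (p : V) :
    MDifferentiableAt (𝓡 (n - 1)) (𝓡 n) x p :=
  (h.smooth p).mdifferentiableAt (by simp)

theorem darbouxPoint_mem_generator (h : IsCanalHypersurface n m r x z π) (p : V) :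
    darbouxPoint (x p) ∈ generator r z (π p) := by
  obtain ⟨O, Z, hp, hZ⟩ := h.smooth_family (π p)
  exact mem_characteristic_of_homogeneousTangent_le (Y := fun q => darbouxPoint (x q))
    hZ.isSmoothEquationOn_polarFamily hp (h.mdifferentiableAt_param p) (h.submersion p)
    (mdifferentiableAt_darbouxPoint_comp (h.mdifferentiableAt p))
    (Eventually.of_forall fun q => (h.touches q).1) (homogeneousTangent_le_iff.2 (h.touches p))

theorem darbouxPoint_notMem_projectiveTangent (h : IsCanalHypersurface n m r x z π) (p : V) :
    darbouxPoint (x p) ∉ projectiveTangent (𝓡 r) z (π p) := by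
  intro hp
  have hfiber : ∀ q, π q = π p → darbouxPoint (x q) = darbouxPoint (x p) := fun q hq => by
    have hmem := h.darbouxPoint_mem_generator q
    rw [generator, characteristic_polarFamily h.smooth_family, hq] at hmem
    rw [darbouxForm_darbouxPoint_eq_zero_iff.1 (hmem _ hp)]
  have hker : ∀ v, mfderiv (𝓡 (n - 1)) (𝓡 r) π p v = 0 → v = 0 := fun v hv =>
    (injective_iff_map_eq_zero _).1
      (injective_mvfderiv_darbouxPoint_comp (h.mdifferentiableAt p) (h.immersion p)) v
      (mvfderiv_apply_eq_zero_of_eqOn_fiber ((h.smooth_param p).of_le (by simp))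
        (((contMDiff_darbouxPoint.comp h.smooth) p).of_le (by simp)) (h.submersion p)
        (Eventually.of_forall hfiber) hv)
  have hdim : finrank ℝ (EuclideanSpace ℝ (Fin (n - 1))) ≤ finrank ℝ (EuclideanSpace ℝ (Fin r)) :=
    LinearMap.finrank_le_finrank_of_injective
      (f := (mfderiv (𝓡 (n - 1)) (𝓡 r) π p).toLinearMap) ((injective_iff_map_eq_zero _).2 hker)
  rw [finrank_euclideanSpace_fin, finrank_euclideanSpace_fin] at hdim
  have := h.dim
  have := h.one_le_m
  omega

theorem exists_isRegularHypersurfacePoint_sweep (h : IsCanalHypersurface n m r x z π) {k : ℕ}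
    {O : Set W} {a : W → Fin k → Polyspherical n} (ha : IsSmoothFrameOn (𝓡 r) (generator r z) O a)
    {w : W} (hw : w ∈ O) :
    ∃ t, IsRegularHypersurfacePoint ((𝓡 r).prod 𝓘(ℝ, Fin k → ℝ)) (sweep a) (w, t) := by
  obtain ⟨p, rfl⟩ := h.surjective w
  obtain ⟨O₁, Z, hp, hZ⟩ := h.smooth_family (π p)
  have hx := h.mdifferentiableAt p
  refine ha.exists_isRegularHypersurfacePoint_sweep (Y := fun q => darbouxPoint (x q))
    hZ.isSmoothEquationOn_polarFamily hw hp (h.mdifferentiableAt_param p)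
    (mdifferentiableAt_darbouxPoint_comp hx) (Eventually.of_forall h.darbouxPoint_mem_generator)
    (fun h₀ => one_ne_zero (congrArg Prod.snd h₀)) ?_ fun hle => ?_
  · rw [finrank_homogeneousTangent_darbouxPoint_comp hx (h.immersion p),
      finrank_polyspherical, finrank_euclideanSpace_fin]
    omega
  · rw [characteristic_polarFamily h.smooth_family] at hle
    exact h.darbouxPoint_notMem_projectiveTangent p <|
      (Submodule.span_singleton_le_iff_mem _ _).1 <|
        polar_le_polar_iff.1 (hle.trans (homogeneousTangent_darbouxPoint_comp_le hx))

end IsCanalHypersurface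

theorem theorem5 (n m r : ℕ)
    {V : Type*} [TopologicalSpace V] [ChartedSpace (EuclideanSpace ℝ (Fin (n - 1))) V]
    [IsManifold (𝓡 (n - 1)) ∞ V]
    {W : Type*} [TopologicalSpace W] [ChartedSpace (EuclideanSpace ℝ (Fin r)) W]
    [IsManifold (𝓡 r) ∞ W]
    (x : V → ConformalSpace n) (z : W → ℙ ℝ (Polyspherical n)) (π : V → W)
    (h : IsCanalHypersurface n m r x z π) :
    -- the generators are planes of dimension `m + 1`, polar to the tangent spaces of the family
    (∀ w, generator r z w = polar (projectiveTangent (𝓡 r) z w) ∧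
      Module.finrank ℝ (generator r z w) = (m + 1) + 1) ∧
    -- the envelope of the polar hyperplanes is the union of these planes
    hyperplaneEnvelope (𝓡 r) (polarFamily z) =
      {y | ∃ w, y.submodule ≤ polar (projectiveTangent (𝓡 r) z w)} ∧
    -- the planes depend smoothly on the `r` parameters
    (∀ w, ∃ (O : Set W) (a : W → Fin (m + 2) → Polyspherical n),
      w ∈ O ∧ IsSmoothFrameOn (𝓡 r) (generator r z) O a) ∧
    -- they sweep out a tangentially degenerate hypersurface of rank `r`
    ∀ (O : Set W) (a : W → Fin (m + 2) → Polyspherical n),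
      IsSmoothFrameOn (𝓡 r) (generator r z) O a →
      IsTangentiallyDegenerateOn ((𝓡 r).prod 𝓘(ℝ, Fin (m + 2) → ℝ)) (sweep a)
        (O ×ˢ Set.univ) r ∧
      -- almost all points of each generator are regular
      (∀ w ∈ O, Dense {t : Fin (m + 2) → ℝ |
        IsRegularHypersurfacePoint ((𝓡 r).prod 𝓘(ℝ, Fin (m + 2) → ℝ)) (sweep a) (w, t)}) ∧
      -- and there the tangent hyperplane is the polar hyperplane that belongs to the generator
      ∀ w ∈ O, ∀ t : Fin (m + 2) → ℝ,
        IsRegularHypersurfacePoint ((𝓡 r).prod 𝓘(ℝ, Fin (m + 2) → ℝ)) (sweep a) (w, t) →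
          homogeneousTangent ((𝓡 r).prod 𝓘(ℝ, Fin (m + 2) → ℝ)) (sweep a) (w, t) =
            polarFamily z w := by
  have hn := h.dim
  have hm := h.one_le_m
  have hgen := characteristic_polarFamily h.smooth_family
  have hfinrank : ∀ w, finrank ℝ (generator r z w) = m + 2 := fun w => by
    rw [generator, hgen, finrank_polar, h.rank_family]
    omega
  choose N Z hN hZ using h.smooth_family
  have hξ w := (hZ w).isSmoothEquationOn_polarFamily
  refine ⟨fun w => ⟨hgen w, hfinrank w⟩, ?_, fun w => ?_, fun O a ha => ?_⟩
  · ext y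
    exact exists_congr fun w => by rw [hgen]
  · obtain ⟨U, hU, a, ha⟩ :=
      exists_isSmoothFrameOn_characteristic (hξ w) (fun q _ => hfinrank q) (hN w)
    exact ⟨U, a, hU, ha⟩
  · have hreg : ∀ w ∈ O, ∃ t, IsRegularHypersurfacePoint _ (sweep a) (w, t) := fun w hw =>
      h.exists_isRegularHypersurfacePoint_sweep ha hw
    refine ⟨ha.isTangentiallyDegenerateOn_sweep
      (fun w _ => (hZ w).hasDualRankAt_polarFamily (hN w) (h.rank_family w)) hreg
      (by rw [finrank_polyspherical]; omega), fun w hw => ?_, fun w hw t ht => ?_⟩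
    · obtain ⟨t₀, ht₀⟩ := hreg w hw
      exact ha.dense_isRegularHypersurfacePoint_sweep (hξ w) hw (hN w) ht₀
    · exact ha.homogeneousTangent_sweep_eq (hξ w) hw (hN w) ht
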